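/- Let $M$ be a symmetric monoidal model category: a model category with a closed symmetric monoidal structure $(\otimes,\mathbf 1,[-,-])$ satisfying the pushout-product axiom and the unit axiom (for every cofibrant replacement $Q\to\mathbf 1$, i.e. weak equivalence with $Q$ cofibrant, and every cofibrant $X$, the map $Q\otimes X\to\mathbf 1\otimes X$ is a weak equivalence), and assume that $M$ has all small limits and colimits. Let $A$ be a small Reedy category: a small category with wide subcategories $A^{\leftarrow}$ and $A^{\to}$ and a degree function from its objects to a well-ordered set such that nonidentity morphisms of $A^{\leftarrow}$ strictly lower the degree, nonidentity morphisms of $A^{\to}$ strictly raise it, and every morphism factors uniquely as a morphism of $A^{\leftarrow}$ followed by a morphism of $A^{\to}$. Let $M(A)$ be the category of functors $A^{\mathrm{op}}\to M$, where $A^{\mathrm{op}}$ has the Reedy structure with raising morphisms $(A^{\leftarrow})^{\mathrm{op}}$ and lowering morphisms $(A^{\to})^{\mathrm{op}}$. For $X\in M(A)$ and $\alpha\in A^{\mathrm{op}}$, the latching object $L_\alpha X$ is the colimit of $X_\beta$ over the nonidentity raising morphisms $\beta\to\alpha$ of $A^{\mathrm{op}}$, and the matching object $M_\alpha X$ is the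 limit of $X_\beta$ over the nonidentity lowering morphisms $\alpha\to\beta$ of $A^{\mathrm{op}}$. Then $M(A)$ has the Reedy model structure, in which a morphism $X\to Y$ is a weak equivalence if and only if every $X_\alpha\to Y_\alpha$ is one, a cofibration if and only if every $X_\alpha\sqcup_{L_\alpha X}L_\alpha Y\to Y_\alpha$ is one, and a fibration if and only if every $X_\alpha\to M_\alpha X\times_{M_\alpha Y}Y_\alpha$ is one. With $$\mathrm{Hom}(X,Y)=\int_{\alpha}[X_\alpha,Y_\alpha],\qquad (Z\otimes X)_\alpha=Z\otimes X_\alpha,\qquad (Y^Z)_\alpha=[Z,Y_\alpha]\qquad(Z\in M,\ X,Y\in M(A)),$$ the Reedy model category $M(A)$ is an $M$-model category. That is: 1. $M(A)$ is an $M$-enriched category with hom objects $\mathrm{Hom}(X,Y)$, tensored by $Z\otimes X$ and cotensored by $Y^Z$: there are natural bijections $M(A)(Z\otimes X,Y)\cong M(Z,\mathrm{Hom}(X,Y))\cong M(A)(X,Y^Z)$, and the induced morphisms $\mathrm{Hom}(Z\otimes X,Y)\to[Z,\mathrm{Hom}(X,Y)]$ and $\mathrm{Hom}(X,Y^Z)\to[Z,\mathrm{Hom}(X,Y)]$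 of $M$ are isomorphisms. 2. (Pushout-product axiom) If $f\colon Z\to Z'$ is a cofibration of $M$ and $i\colon X\to Y$ is a Reedy cofibration, then $(Z\otimes Y)\sqcup_{Z\otimes X}(Z'\otimes X)\to Z'\otimes Y$ is a Reedy cofibration, and it is a weak equivalence if $f$ or $i$ is. 3. (Unit axiom) For every cofibrant replacement $Q\to\mathbf 1$ in $M$ and every Reedy cofibrant $X$, the map $Q\otimes X\to\mathbf 1\otimes X$ is a weak equivalence. -/

import Mathlib

open CategoryTheory Limits MonoidalCategory HomotopicalAlgebra Opposite
open scoped CategoryTheory.MonoidalClosed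

universe w t v u v₁ u₁ v₂ u₂ v₃ u₃

noncomputable section

/-! ### Latching and matching objects

`K` is a category with a class `R` of "raising" (degree-increasing) and a class `L` of "lowering"
(degree-decreasing) morphisms. -/

section LatchingMatching

variable {K : Type w} [Category.{w} K] {M : Type u} [Category.{v} M]

/-- The latching category at `c`: the full subcategory of the slice over `c` of the wide
subcategory `R` on the nonidentity morphisms `b ⟶ c` in `R`. -/
abbrev LatchingCategory (R : MorphismProperty K) [R.IsMultiplicative] (c : K) : Type w :=
  (R ⊓ (MorphismProperty.identities K)ᶜ).Over R c

/-- The matching category at `c`: the full subcategory of the slice under `c` of the wide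
subcategory `L` on the nonidentity morphisms `c ⟶ b` in `L`. -/
abbrev MatchingCategory (L : MorphismProperty K) [L.IsMultiplicative] (c : K) : Type w :=
  (L ⊓ (MorphismProperty.identities K)ᶜ).Under L c

/-- The forgetful functor from the latching category. -/
@[simps]
def latchingForget (R : MorphismProperty K) [R.IsMultiplicative] (c : K) :
    LatchingCategory R c ⥤ K where
  obj b := b.left
  map f := f.left

/-- The forgetful functor from the matching category. -/
@[simps]
def matchingForget (L : MorphismProperty K) [L.IsMultiplicative] (c : K) :
    MatchingCategory L c ⥤ K where
  obj b := b.right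
  map f := f.right

section Latching

variable [HasColimitsOfSize.{w, w} M]
variable (R : MorphismProperty K) [R.IsMultiplicative]

/-- The latching object of `X` at `c`. -/
abbrev latchingObj (X : K ⥤ M) (c : K) : M :=
  colimit (latchingForget R c ⋙ X)

/-- The cocone with vertex `X.obj c` given by the maps `X.map b.hom`, for `b.hom : b ⟶ c` in the
latching category. -/
abbrev latchingCocone (X : K ⥤ M) (c : K) : Cocone (latchingForget R c ⋙ X) where
  pt := X.obj c
  ι :=
    { app := fun b ↦ X.map (Y := c) b.hom
      naturality := fun b b' f ↦ by
        change X.map f.left ≫ X.map (Y := c) b'.hom = X.map (Y := c) b.hom ≫ 𝟙 _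
        rw [Category.comp_id]
        exact (X.map_comp _ _).symm.trans (congrArg X.map (MorphismProperty.Over.w f)) }

/-- The canonical map from the latching object of `X` at `c` to `X.obj c`. -/
def latchingι (X : K ⥤ M) (c : K) : latchingObj R X c ⟶ X.obj c :=
  colimit.desc (latchingForget R c ⋙ X) (latchingCocone R X c)

/-- Functoriality of the latching object. -/
def latchingMap {X Y : K ⥤ M} (φ : X ⟶ Y) (c : K) : latchingObj R X c ⟶ latchingObj R Y c :=
  colimMap (Functor.whiskerLeft (latchingForget R c) φ)

lemma ι_latchingι (X : K ⥤ M) (c : K) (b : LatchingCategory R c) :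
    colimit.ι (latchingForget R c ⋙ X) b ≫ latchingι R X c = X.map (Y := c) b.hom :=
  colimit.ι_desc _ _

lemma ι_latchingMap {X Y : K ⥤ M} (φ : X ⟶ Y) (c : K) (b : LatchingCategory R c) :
    colimit.ι (latchingForget R c ⋙ X) b ≫ latchingMap R φ c =
      (Functor.whiskerLeft (latchingForget R c) φ).app b ≫ colimit.ι (latchingForget R c ⋙ Y) b :=
  ι_colimMap _ _

lemma latchingMap_comp_latchingι {X Y : K ⥤ M} (φ : X ⟶ Y) (c : K) :
    latchingMap R φ c ≫ latchingι R Y c = latchingι R X c ≫ φ.app c := by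
  apply colimit.hom_ext
  intro b
  rw [← Category.assoc, ← Category.assoc, ι_latchingMap, ι_latchingι, Category.assoc, ι_latchingι]
  exact (φ.naturality _).symm

/-- The relative latching map `X_c ⊔_{L_c X} L_c Y ⟶ Y_c` of `φ : X ⟶ Y` at `c`. -/
def relativeLatchingMap [HasPushouts M] {X Y : K ⥤ M} (φ : X ⟶ Y) (c : K) :
    pushout (latchingι R X c) (latchingMap R φ c) ⟶ Y.obj c :=
  pushout.desc (φ.app c) (latchingι R Y c) (latchingMap_comp_latchingι R φ c).symm

end Latching

section Matching

variable [HasLimitsOfSize.{w, w} M]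
variable (L : MorphismProperty K) [L.IsMultiplicative]

/-- The matching object of `X` at `c`. -/
abbrev matchingObj (X : K ⥤ M) (c : K) : M :=
  limit (matchingForget L c ⋙ X)

/-- The cone with vertex `X.obj c` given by the maps `X.map b.hom`, for `b.hom : c ⟶ b` in the
matching category. -/
abbrev matchingCone (X : K ⥤ M) (c : K) : Cone (matchingForget L c ⋙ X) where
  pt := X.obj c
  π :=
    { app := fun b ↦ X.map (X := c) b.hom
      naturality := fun b b' f ↦ by
        change 𝟙 _ ≫ X.map (X := c) b'.hom = X.map (X := c) b.hom ≫ X.map f.right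
        rw [Category.id_comp]
        exact (congrArg X.map (MorphismProperty.Under.w f).symm).trans (X.map_comp _ _) }

/-- The canonical map from `X.obj c` to the matching object of `X` at `c`. -/
def matchingπ (X : K ⥤ M) (c : K) : X.obj c ⟶ matchingObj L X c :=
  limit.lift (matchingForget L c ⋙ X) (matchingCone L X c)

/-- Functoriality of the matching object. -/
def matchingMap {X Y : K ⥤ M} (φ : X ⟶ Y) (c : K) : matchingObj L X c ⟶ matchingObj L Y c :=
  limMap (Functor.whiskerLeft (matchingForget L c) φ)

lemma matchingπ_π (X : K ⥤ M) (c : K) (b : MatchingCategory L c) :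
    matchingπ L X c ≫ limit.π (matchingForget L c ⋙ X) b = X.map (X := c) b.hom :=
  limit.lift_π _ _

lemma matchingMap_π {X Y : K ⥤ M} (φ : X ⟶ Y) (c : K) (b : MatchingCategory L c) :
    matchingMap L φ c ≫ limit.π (matchingForget L c ⋙ Y) b =
      limit.π (matchingForget L c ⋙ X) b ≫ (Functor.whiskerLeft (matchingForget L c) φ).app b :=
  limMap_π _ _

lemma matchingπ_comp_matchingMap {X Y : K ⥤ M} (φ : X ⟶ Y) (c : K) :
    matchingπ L X c ≫ matchingMap L φ c = φ.app c ≫ matchingπ L Y c := by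
  apply limit.hom_ext
  intro b
  rw [Category.assoc, Category.assoc, matchingMap_π, matchingπ_π, ← Category.assoc, matchingπ_π]
  exact φ.naturality _

/-- The relative matching map `X_c ⟶ M_c X ×_{M_c Y} Y_c` of `φ : X ⟶ Y` at `c`. -/
def relativeMatchingMap [HasPullbacks M] {X Y : K ⥤ M} (φ : X ⟶ Y) (c : K) :
    X.obj c ⟶ pullback (matchingMap L φ c) (matchingπ L Y c) :=
  pullback.lift (matchingπ L X c) (φ.app c) (matchingπ_comp_matchingMap L φ c)

end Matching

/-- A model structure on the functor category `K ⥤ M` is the Reedy model structure, with respect to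
the classes `L` of lowering and `R` of raising morphisms of `K`, if its weak equivalences are the
objectwise ones, its cofibrations are the morphisms whose relative latching maps are cofibrations,
and its fibrations are the morphisms whose relative matching maps are fibrations. -/
structure IsReedyModelStructure [ModelCategory M]
    [HasLimitsOfSize.{w, w} M] [HasColimitsOfSize.{w, w} M]
    (L R : MorphismProperty K) [L.IsMultiplicative] [R.IsMultiplicative]
    (h : ModelCategory (K ⥤ M)) : Prop where
  weakEquivalence_iff {X Y : K ⥤ M} (φ : X ⟶ Y) :
    h.categoryWithWeakEquivalences.weakEquivalences φ ↔ ∀ c, WeakEquivalence (φ.app c)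
  cofibration_iff {X Y : K ⥤ M} (φ : X ⟶ Y) :
    h.categoryWithCofibrations.cofibrations φ ↔ ∀ c, Cofibration (relativeLatchingMap R φ c)
  fibration_iff {X Y : K ⥤ M} (φ : X ⟶ Y) :
    h.categoryWithFibrations.fibrations φ ↔ ∀ c, Fibration (relativeMatchingMap L φ c)

end LatchingMatching

/-! ### Monoidal and enriched model categories -/

section Enriched

/-- The pushout-product axiom for a bifunctor `T` between model categories: the pushout-product
`T(Z', X) ⊔_{T(Z, X)} T(Z, Y) ⟶ T(Z', Y)` of cofibrations `f : Z ⟶ Z'` and `i : X ⟶ Y` is a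
cofibration, which is a weak equivalence if `f` or `i` is. -/
structure PushoutProductAxiom {C₁ : Type u₁} {C₂ : Type u₂} {C₃ : Type u₃}
    [Category.{v₁} C₁] [Category.{v₂} C₂] [Category.{v₃} C₃]
    [ModelCategory C₁] [ModelCategory C₂] [ModelCategory C₃]
    (T : C₁ ⥤ C₂ ⥤ C₃) : Prop where
  cofibration {Z Z' : C₁} (f : Z ⟶ Z') {X Y : C₂} (i : X ⟶ Y)
    (sq : T.PushoutObjObj f i) (hf : Cofibration f) (hi : Cofibration i) :
    Cofibration sq.ι
  weakEquivalence {Z Z' : C₁} (f : Z ⟶ Z') {X Y : C₂} (i : X ⟶ Y)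
    (sq : T.PushoutObjObj f i) (hf : Cofibration f) (hi : Cofibration i)
    (h : WeakEquivalence f ∨ WeakEquivalence i) :
    WeakEquivalence sq.ι

/-- The unit axiom for a tensoring `T : V ⥤ C ⥤ C`: for every cofibrant replacement `q : Q ⟶ 𝟙_ V`
of the unit and every cofibrant `X`, the map `T(Q, X) ⟶ T(𝟙_ V, X)` is a weak equivalence. -/
def UnitAxiom {V : Type u₁} {C : Type u₂} [Category.{v₁} V] [Category.{v₂} C]
    [MonoidalCategory V] [ModelCategory V] [ModelCategory C] (T : V ⥤ C ⥤ C) : Prop :=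
  ∀ ⦃Q : V⦄ (q : Q ⟶ 𝟙_ V), IsCofibrant Q → WeakEquivalence q →
    ∀ X : C, IsCofibrant X → WeakEquivalence ((T.map q).app X)

/-- Symmetric monoidal model categories: closed symmetric monoidal categories with a model
structure which satisfies the pushout-product axiom and the unit axiom. -/
class SymmetricMonoidalModelCategory (M : Type u) [Category.{v} M] [MonoidalCategory M]
    [SymmetricCategory M] [MonoidalClosed M] [ModelCategory M] : Prop where
  pushoutProduct : PushoutProductAxiom (curriedTensor M)
  unit : UnitAxiom (curriedTensor M)

section TensoredCotensored

variable {V : Type u₁} {C : Type u₂} [Category.{v₁} V] [Category.{v₂} C]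
  [MonoidalCategory V] [SymmetricCategory V] [MonoidalClosed V] [EnrichedOrdinaryCategory V C]
  {T : V ⥤ C ⥤ C} {H : Vᵒᵖ ⥤ C ⥤ C}

/-- The morphism `Z ⟶ Hom(X, T(Z, X))` of `V` corresponding to the identity of `T(Z, X)`. -/
def tensorUnitMap (adj : T.flip ⊣₂ eHomFunctor V C) (Z : V) (X : C) :
    Z ⟶ (X ⟶[V] (T.obj Z).obj X) :=
  adj.homEquiv (𝟙 ((T.obj Z).obj X))

/-- The comparison morphism `Hom(T(Z, X), Y) ⟶ [Z, Hom(X, Y)]` of `V`, given by composition in the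
`V`-category `C`. -/
def tensorComparison (adj : T.flip ⊣₂ eHomFunctor V C) (Z : V) (X Y : C) :
    ((T.obj Z).obj X ⟶[V] Y) ⟶ (ihom Z).obj (X ⟶[V] Y) :=
  MonoidalClosed.curry
    (tensorUnitMap adj Z X ▷ ((T.obj Z).obj X ⟶[V] Y) ≫ eComp V X ((T.obj Z).obj X) Y)

/-- The morphism `Z ⟶ Hom(H(Z, Y), Y)` of `V` corresponding to the identity of `H(Z, Y)`. -/
def cotensorCounitMap (adj : T.flip ⊣₂ eHomFunctor V C) (adj' : T ⊣₂ H) (Z : V) (Y : C) :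
    Z ⟶ ((H.obj (op Z)).obj Y ⟶[V] Y) :=
  adj.homEquiv (adj'.homEquiv.symm (𝟙 ((H.obj (op Z)).obj Y)) :
    (T.obj Z).obj ((H.obj (op Z)).obj Y) ⟶ Y)

/-- The comparison morphism `Hom(X, H(Z, Y)) ⟶ [Z, Hom(X, Y)]` of `V`, given by composition in the
`V`-category `C`. -/
def cotensorComparison (adj : T.flip ⊣₂ eHomFunctor V C) (adj' : T ⊣₂ H) (Z : V) (X Y : C) :
    (X ⟶[V] (H.obj (op Z)).obj Y) ⟶ (ihom Z).obj (X ⟶[V] Y) :=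
  MonoidalClosed.curry
    ((β_ Z (X ⟶[V] (H.obj (op Z)).obj Y)).hom ≫
      (X ⟶[V] (H.obj (op Z)).obj Y) ◁ cotensorCounitMap adj adj' Z Y ≫
        eComp V X ((H.obj (op Z)).obj Y) Y)

variable (V C T H) in
/-- The `V`-category `C` is tensored by `T` and cotensored by `H`: the functors `T`, `H` and
`Hom` form an adjunction of two variables
`C(T(Z, X), Y) ≃ V(Z, Hom(X, Y))`, `C(T(Z, X), Y) ≃ C(X, H(Z, Y))`,
and the resulting comparison morphisms of `V` are isomorphisms
`Hom(T(Z, X), Y) ≅ [Z, Hom(X, Y)]` and `Hom(X, H(Z, Y)) ≅ [Z, Hom(X, Y)]`. -/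
structure TensoredCotensored where
  homAdj : T.flip ⊣₂ eHomFunctor V C
  cotensorAdj : T ⊣₂ H
  isIso_tensorComparison (Z : V) (X Y : C) : IsIso (tensorComparison homAdj Z X Y)
  isIso_cotensorComparison (Z : V) (X Y : C) :
    IsIso (cotensorComparison homAdj cotensorAdj Z X Y)

variable (V C T H) in
/-- `C` is a model `V`-category for the tensoring `T` and the cotensoring `H`: it is a model
category and a `V`-category, tensored by `T` and cotensored by `H`, and `T` satisfies the
pushout-product axiom and the unit axiom. -/
structure IsEnrichedModelCategory [ModelCategory V] [ModelCategory C] : Prop where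
  tensoredCotensored : Nonempty (TensoredCotensored V C T H)
  pushoutProduct : PushoutProductAxiom T
  unit : UnitAxiom T

end TensoredCotensored

end Enriched

/-! ### The enrichment of a diagram category -/

section Diagrams

variable (K : Type w) [Category.{w} K] (M : Type u) [Category.{v} M]
  [MonoidalCategory M] [MonoidalClosed M]

/-- The `M`-enrichment of `K ⥤ M`, with `Hom(X, Y)` the end over `c` of the internal homs
from `X_c` to `Y_c`. -/
instance diagramEnrichment [HasLimitsOfSize.{w, w} M] : EnrichedOrdinaryCategory M (K ⥤ M) :=
  Enriched.FunctorCategory.enrichedOrdinaryCategory M M K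

/-- The objectwise tensoring `(Z ⊗ X)_c = Z ⊗ X_c` of `K ⥤ M` over `M`. -/
def diagramTensor : M ⥤ (K ⥤ M) ⥤ (K ⥤ M) :=
  curriedTensor M ⋙ Functor.whiskeringRight K M M

/-- The objectwise cotensoring `H(Z, Y)_c = [Z, Y_c]` of `K ⥤ M` over `M`. -/
def diagramCotensor : Mᵒᵖ ⥤ (K ⥤ M) ⥤ (K ⥤ M) :=
  MonoidalClosed.internalHom ⋙ Functor.whiskeringRight K M M

end Diagrams

end

/-! Everything is built by induction on degree. Once a diagram or a map is known on objects of
degree less than that of `c`, extending it to `c` only involves the latching and matching objects at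
`c`. A composite of a raising and a lowering map through `c` joins objects of lower degree, so it is
already under control, and unique factorization shows that no other maps need checking.

Consequently a lift of `i` against `p` is found by solving, at each `c`, a lifting problem of the
relative latching map of `i` against the relative matching map of `p`
(`hasLiftingProperty_of_relative`). Likewise, a factorization `X ⟶ Z ⟶ Y` is found by factoring, at
each `c`, the map from `X_c ⊔_{L_c X} L_c Z` to `M_c Z ×_{M_c Y} Y_c` (`exists_isGood`,
`exists_factorization`). So every weak factorization system on `M` induces one on diagrams
(`isWeakFactorizationSystem`). The two systems of `M` give a model structure because relative
latching maps are trivial cofibrations exactly when they are cofibrations and the map is an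
objectwise weak equivalence, and dually (`relativeLatchingClass_trivialCofibrations_iff`,
`relativeMatchingClass_trivialFibrations_iff`). This rests on `hasLiftingProperty_latchingMap`: the
map of latching objects at `c` inherits lifting properties from the relative latching maps in lower
degrees.

Membership in a left class is tested by lifting against the right class, so a statement about a
relative latching map becomes one about families of maps out of the values of the diagrams. For the
pushout-product axiom, the closed structure moves `f` to the other side of the lifting problem,
which reduces the axiom at `c` to the axiom of `M` for `f` and the relative latching map of `i`
(`hasLiftingProperty_relativeLatchingMap_of_isPushout`). The unit axiom is objectwise, since Reedy
cofibrant diagrams are objectwise cofibrant.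

For the enrichment, `Hom(X, Y)` is an end, so morphisms into it are handled through its projections.
On these the comparison morphisms become `[Z ⊗ A, B] ⟶ [Z, [A, B]]` and `[A, [Z, B]] ⟶ [Z, [A, B]]`,
which are natural isomorphisms and therefore pass to the end (`isIso_of_diagramHomπ`). -/

noncomputable section

/-! ### Dependent choice along a degree function -/

section DependentChoice

variable {ι : Type*} {D : Type*} [LinearOrder D] [WellFoundedLT D] (deg : ι → D)

/-- Dependent choice along a well-founded degree function: choose a term `g c : T c` and data
`p c : P c _ (g c)`, where `P` may depend on the terms in lower degrees, subject to a condition `Q`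
which may depend on both the terms and the data in lower degrees. -/
theorem exists_dependent_choice (T : ι → Type*)
    (P : ∀ c, (∀ b, deg b < deg c → T b) → T c → Type*)
    (Q : ∀ c (g : ∀ b, deg b < deg c → T b)
      (_ : ∀ b (h : deg b < deg c), P b (fun a ha ↦ g a (ha.trans h)) (g b h)) (x : T c),
      P c g x → Prop)
    (step : ∀ c (g : ∀ b, deg b < deg c → T b)
      (p : ∀ b (h : deg b < deg c), P b (fun a ha ↦ g a (ha.trans h)) (g b h)),
      (∀ b (h : deg b < deg c), Q b (fun a ha ↦ g a (ha.trans h))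
        (fun a ha ↦ p a (ha.trans h)) (g b h) (p b h)) → ∃ x px, Q c g p x px) :
    ∃ (g : ∀ c, T c) (p : ∀ c, P c (fun b _ ↦ g b) (g c)),
      ∀ c, Q c (fun b _ ↦ g b) (fun b _ ↦ p b) (g c) (p c) := by
  classical
  -- The type of the data at `c` depends on the earlier choices, so each stage stores its own copy
  -- of them. This makes `N c` a type independent of the recursion; `good` demands that the copy
  -- agree with what the recursion produced.
  let N : ι → Type _ := fun c ↦ Σ (g : ∀ b, deg b < deg c → T b) (x : T c), P c g x
  let good : ∀ c, (∀ b, deg b < deg c → Option (N b)) → N c → Prop := fun c rec n ↦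
    ∃ p : ∀ b (h : deg b < deg c), P b (fun a ha ↦ n.1 a (ha.trans h)) (n.1 b h),
      (∀ b h, rec b h = some ⟨fun a ha ↦ n.1 a (ha.trans h), n.1 b h, p b h⟩) ∧
      Q c n.1 p n.2.1 n.2.2
  let wf : WellFounded (fun b c : ι ↦ deg b < deg c) := InvImage.wf deg wellFounded_lt
  -- The value `none` is a default for failure, needed to define the recursion before its stages are
  -- known to be good; `all` rules it out.
  let F : ∀ c, (∀ b, deg b < deg c → Option (N b)) → Option (N c) := fun c rec ↦
    if H : ∃ n, good c rec n then some H.choose else none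
  let n : ∀ c, Option (N c) := wf.fix F
  have n_eq : ∀ c, n c = F c (fun b _ ↦ n b) := fun c ↦ wf.fix_eq F c
  have sigma_eq : ∀ c (s : N c) (g : ∀ b, deg b < deg c → T b) (h : s.1 = g),
      s = ⟨g, s.2.1, h ▸ s.2.2⟩ := by
    rintro c ⟨g, x, px⟩ _ rfl
    rfl
  -- From good stages on a down-closed set, a single coherent family is extracted. This is used on
  -- the degrees below `c`, to feed `step`, and at the end on all objects.
  have main : ∀ (S : ι → Prop), (∀ b, S b → ∀ a, deg a < deg b → S a) →
      (∀ b, S b → ∃ m, n b = some m ∧ good b (fun a _ ↦ n a) m) →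
      ∃ (g : ∀ b, S b → T b) (p : ∀ b (h : S b) (hS : ∀ a, deg a < deg b → S a),
        P b (fun a ha ↦ g a (hS a ha)) (g b h)),
        (∀ b h hS, n b = some ⟨fun a ha ↦ g a (hS a ha), g b h, p b h hS⟩) ∧
        ∀ b h (hS : ∀ a, deg a < deg b → S a), Q b (fun a ha ↦ g a (hS a ha))
          (fun a ha ↦ p a (hS a ha) (fun a' ha' ↦ hS a' (ha'.trans ha))) (g b h) (p b h hS) := by
    intro S hS H
    choose m hm q hq hQ using H
    have e : ∀ b (h : S b), (m b h).1 = fun a ha ↦ (m a (hS b h a ha)).2.1 := by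
      intro b h
      funext a ha
      have h₁ := (hq b h a ha).symm.trans (hm a (hS b h a ha))
      exact congrArg (fun s : N a ↦ s.2.1) (Option.some.inj h₁)
    have hn : ∀ b h (_ : ∀ a, deg a < deg b → S a), n b = some ⟨fun a ha ↦
        (m a (hS b h a ha)).2.1, (m b h).2.1, e b h ▸ (m b h).2.2⟩ := fun b h _ ↦
      (hm b h).trans (congrArg some (sigma_eq b (m b h) _ (e b h)))
    refine ⟨fun b h ↦ (m b h).2.1, fun b h _ ↦ e b h ▸ (m b h).2.2, hn, ?_⟩
    intro b h hb
    have h₁ := hq b h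
    have h₂ := hQ b h
    generalize q b h = q' at h₁ h₂
    -- The stored family can be replaced by the extracted one only in general form, where the
    -- equality between them can be eliminated. The data then coincide because both are read off
    -- from `n a`.
    have key : ∀ (s : N b) (g : ∀ a, deg a < deg b → T a) (hg : s.1 = g)
        (q' : ∀ a (ha : deg a < deg b), P a (fun a' ha' ↦ s.1 a' (ha'.trans ha)) (s.1 a ha))
        (p : ∀ a (ha : deg a < deg b), P a (fun a' ha' ↦ g a' (ha'.trans ha)) (g a ha)),
        (∀ a ha, n a = some ⟨fun a' ha' ↦ s.1 a' (ha'.trans ha), s.1 a ha, q' a ha⟩) →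
        (∀ a ha, n a = some ⟨fun a' ha' ↦ g a' (ha'.trans ha), g a ha, p a ha⟩) →
        Q b s.1 q' s.2.1 s.2.2 → Q b g p s.2.1 (hg ▸ s.2.2) := by
      rintro ⟨g, x, px⟩ _ rfl q' p h₁ h₂ h₃
      have : q' = p := by
        funext a ha
        have := Option.some.inj ((h₁ a ha).symm.trans (h₂ a ha))
        exact eq_of_heq (Sigma.mk.inj (eq_of_heq (Sigma.mk.inj this).2)).2
      subst this
      exact h₃
    exact key _ _ (e b h) q' _ h₁ (fun a ha ↦ hn a (hS b h a ha) (hS a (hS b h a ha))) h₂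
  have all : ∀ c, ∃ m, n c = some m ∧ good c (fun a _ ↦ n a) m := by
    intro c
    induction c using wf.induction with
    | _ c ih =>
      obtain ⟨g, p, hn, hQ⟩ := main (fun b ↦ deg b < deg c)
        (fun b hb a ha ↦ ha.trans hb) (fun b hb ↦ ih b hb)
      obtain ⟨x, px, hx⟩ := step c g (fun b h ↦ p b h (fun a ha ↦ ha.trans h))
        (fun b h ↦ hQ b h (fun a ha ↦ ha.trans h))
      have H : ∃ m, good c (fun a _ ↦ n a) m :=
        ⟨⟨g, x, px⟩, fun b h ↦ p b h (fun a ha ↦ ha.trans h),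
          fun b h ↦ hn b h (fun a ha ↦ ha.trans h), hx⟩
      refine ⟨H.choose, ?_, H.choose_spec⟩
      rw [n_eq]
      exact dif_pos H
  obtain ⟨g, p, -, hQ⟩ := main (fun _ ↦ True) (fun _ _ _ _ ↦ trivial) (fun b _ ↦ all b)
  exact ⟨fun c ↦ g c trivial, fun c ↦ p c trivial (fun _ _ ↦ trivial),
    fun c ↦ hQ c trivial (fun _ _ ↦ trivial)⟩

/-- Dependent choice along a well-founded degree function, where the conditions on `g c` only
depend on the values of `g` in lower degrees. -/
theorem exists_dependent_choice' (T : ι → Type*)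
    (Q : ∀ c, (∀ b, deg b < deg c → T b) → T c → Prop)
    (step : ∀ c (g : ∀ b, deg b < deg c → T b),
      (∀ b (h : deg b < deg c), Q b (fun a ha ↦ g a (ha.trans h)) (g b h)) → ∃ x, Q c g x) :
    ∃ g : ∀ c, T c, ∀ c, Q c (fun b _ ↦ g b) (g c) := by
  obtain ⟨g, -, hg⟩ := exists_dependent_choice deg T (fun _ _ _ ↦ PUnit.{1})
    (fun c g _ x _ ↦ Q c g x) (fun c g _ H ↦ by
      obtain ⟨x, hx⟩ := step c g H
      exact ⟨x, ⟨⟩, hx⟩)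
  exact ⟨g, hg⟩

end DependentChoice

/-! ### Maps out of relative latching objects and into relative matching objects -/

section Relative

variable {K : Type w} [Category.{w} K] {M : Type u} [Category.{v} M]

/-- The map `b ⟶ c` underlying an object `b` of the latching category at `c`. -/
def latchingHom {R : MorphismProperty K} [R.IsMultiplicative] {c : K} (b : LatchingCategory R c) :
    b.left ⟶ c :=
  b.hom

lemma latchingHom_w {R : MorphismProperty K} [R.IsMultiplicative] {c : K}
    {b b' : LatchingCategory R c} (k : b ⟶ b') : k.left ≫ latchingHom b' = latchingHom b :=
  MorphismProperty.Over.w k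

/-- The map `c ⟶ b` underlying an object `b` of the matching category at `c`. -/
def matchingHom {L : MorphismProperty K} [L.IsMultiplicative] {c : K} (b : MatchingCategory L c) :
    c ⟶ b.right :=
  b.hom

lemma matchingHom_w {L : MorphismProperty K} [L.IsMultiplicative] {c : K}
    {b b' : MatchingCategory L c} (k : b ⟶ b') : matchingHom b ≫ k.right = matchingHom b' :=
  MorphismProperty.Under.w k

section Latching

variable [HasColimitsOfSize.{w, w} M]
variable {R : MorphismProperty K} [R.IsMultiplicative] {X Y : K ⥤ M} {φ : X ⟶ Y} {c : K}

/-- The inclusion of `X_b` in the latching object of `X` at `c`. -/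
def latchingObjι (X : K ⥤ M) (b : LatchingCategory R c) : X.obj b.left ⟶ latchingObj R X c :=
  colimit.ι (latchingForget R c ⋙ X) b

lemma latchingObjι_w (X : K ⥤ M) {b b' : LatchingCategory R c} (k : b ⟶ b') :
    X.map k.left ≫ latchingObjι X b' = latchingObjι X b :=
  colimit.w (latchingForget R c ⋙ X) k

lemma latchingObj_hom_ext {E : M} {f g : latchingObj R X c ⟶ E}
    (h : ∀ b : LatchingCategory R c, latchingObjι X b ≫ f = latchingObjι X b ≫ g) : f = g :=
  colimit.hom_ext h

lemma exists_latchingObj_desc {E : M} (t : ∀ b : LatchingCategory R c, X.obj b.left ⟶ E)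
    (ht : ∀ (b b' : LatchingCategory R c) (k : b ⟶ b'), X.map k.left ≫ t b' = t b) :
    ∃ d : latchingObj R X c ⟶ E, ∀ b : LatchingCategory R c, latchingObjι X b ≫ d = t b :=
  ⟨colimit.desc (latchingForget R c ⋙ X)
    { pt := E
      ι := { app := t
             naturality := fun b b' k ↦ (ht b b' k).trans (Category.comp_id _).symm } },
    fun b ↦ colimit.ι_desc _ b⟩

@[simp]
lemma latchingObjι_latchingι (X : K ⥤ M) (b : LatchingCategory R c) :
    latchingObjι X b ≫ latchingι R X c = X.map (latchingHom b) :=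
  ι_latchingι R X c b

@[simp]
lemma latchingObjι_latchingMap (φ : X ⟶ Y) (b : LatchingCategory R c) :
    latchingObjι X b ≫ latchingMap R φ c = φ.app b.left ≫ latchingObjι Y b :=
  ι_latchingMap R φ c b

variable [HasPushouts M]

variable (R) in
/-- The object `X_c ⊔_{L_c X} L_c Y` for a morphism `φ : X ⟶ Y`. -/
abbrev relativeLatchingObj (φ : X ⟶ Y) (c : K) : M :=
  pushout (latchingι R X c) (latchingMap R φ c)

/-- The map from `Y_b` to the relative latching object at `c`, for `b` in the latching category. -/
def relativeLatchingObjι (φ : X ⟶ Y) (b : LatchingCategory R c) :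
    Y.obj b.left ⟶ relativeLatchingObj R φ c :=
  latchingObjι Y b ≫ pushout.inr (latchingι R X c) (latchingMap R φ c)

@[simp]
lemma inl_relativeLatchingMap (φ : X ⟶ Y) (c : K) :
    pushout.inl (latchingι R X c) (latchingMap R φ c) ≫ relativeLatchingMap R φ c = φ.app c :=
  pushout.inl_desc _ _ _

@[simp]
lemma relativeLatchingObjι_relativeLatchingMap (φ : X ⟶ Y) (b : LatchingCategory R c) :
    relativeLatchingObjι φ b ≫ relativeLatchingMap R φ c = Y.map (latchingHom b) := by
  rw [relativeLatchingObjι, Category.assoc, relativeLatchingMap, pushout.inr_desc,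
    latchingObjι_latchingι]

lemma relativeLatchingObj_hom_ext {E : M} {f g : relativeLatchingObj R φ c ⟶ E}
    (h : pushout.inl (latchingι R X c) (latchingMap R φ c) ≫ f =
      pushout.inl (latchingι R X c) (latchingMap R φ c) ≫ g)
    (h' : ∀ b : LatchingCategory R c,
      relativeLatchingObjι φ b ≫ f = relativeLatchingObjι φ b ≫ g) : f = g := by
  apply pushout.hom_ext h
  apply latchingObj_hom_ext
  intro b
  simpa only [relativeLatchingObjι, Category.assoc] using h' b

lemma exists_relativeLatchingObj_desc {E : M} (s : X.obj c ⟶ E)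
    (t : ∀ b : LatchingCategory R c, Y.obj b.left ⟶ E)
    (ht : ∀ (b b' : LatchingCategory R c) (k : b ⟶ b'), Y.map k.left ≫ t b' = t b)
    (hs : ∀ b : LatchingCategory R c, φ.app b.left ≫ t b = X.map (latchingHom b) ≫ s) :
    ∃ d : relativeLatchingObj R φ c ⟶ E,
      pushout.inl (latchingι R X c) (latchingMap R φ c) ≫ d = s ∧
        ∀ b : LatchingCategory R c, relativeLatchingObjι φ b ≫ d = t b := by
  obtain ⟨d, hd⟩ := exists_latchingObj_desc t ht
  refine ⟨pushout.desc s d ?_, pushout.inl_desc _ _ _, fun b ↦ ?_⟩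
  · apply latchingObj_hom_ext
    intro b
    rw [reassoc_of% @latchingObjι_latchingι, reassoc_of% @latchingObjι_latchingMap, hd, hs]
  · rw [relativeLatchingObjι, Category.assoc, pushout.inr_desc, hd]

/-- The lifting property of a relative latching map, in terms of maps out of the objects of the
diagrams. -/
lemma hasLiftingProperty_relativeLatchingMap_iff {E B : M} (q : E ⟶ B) :
    HasLiftingProperty (relativeLatchingMap R φ c) q ↔
      ∀ (s : X.obj c ⟶ E) (t : ∀ b : LatchingCategory R c, Y.obj b.left ⟶ E) (v : Y.obj c ⟶ B),
        (∀ (b b' : LatchingCategory R c) (k : b ⟶ b'), Y.map k.left ≫ t b' = t b) →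
        (∀ b : LatchingCategory R c, φ.app b.left ≫ t b = X.map (latchingHom b) ≫ s) →
        s ≫ q = φ.app c ≫ v →
        (∀ b : LatchingCategory R c, t b ≫ q = Y.map (latchingHom b) ≫ v) →
        ∃ h : Y.obj c ⟶ E, φ.app c ≫ h = s ∧
          (∀ b : LatchingCategory R c, Y.map (latchingHom b) ≫ h = t b) ∧ h ≫ q = v := by
  constructor
  · intro H s t v ht hs hv htv
    obtain ⟨d, hd, hd'⟩ := exists_relativeLatchingObj_desc s t ht hs
    have sq : CommSq d (relativeLatchingMap R φ c) q v := ⟨by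
      refine relativeLatchingObj_hom_ext ?_ fun b ↦ ?_
      · rw [← Category.assoc, hd, hv, reassoc_of% @inl_relativeLatchingMap]
      · rw [← Category.assoc, hd', htv, reassoc_of% @relativeLatchingObjι_relativeLatchingMap]⟩
    refine ⟨sq.lift, ?_, fun b ↦ ?_, sq.fac_right⟩
    · rw [← inl_relativeLatchingMap (R := R), Category.assoc, sq.fac_left, hd]
    · rw [← relativeLatchingObjι_relativeLatchingMap φ, Category.assoc, sq.fac_left, hd']
  · intro H
    refine ⟨fun {d v} sq ↦ ?_⟩
    obtain ⟨h, h₁, h₂, h₃⟩ := H (pushout.inl _ _ ≫ d) (fun b ↦ relativeLatchingObjι φ b ≫ d) v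
      (fun b b' k ↦ by
        simp only [relativeLatchingObjι, Category.assoc, reassoc_of% @latchingObjι_w])
      (fun b ↦ by
        rw [relativeLatchingObjι, ← reassoc_of% @latchingObjι_latchingι, pushout.condition_assoc,
          reassoc_of% @latchingObjι_latchingMap, Category.assoc])
      (by rw [Category.assoc, sq.w, reassoc_of% @inl_relativeLatchingMap])
      (fun b ↦ by rw [Category.assoc, sq.w, reassoc_of% @relativeLatchingObjι_relativeLatchingMap])
    refine ⟨⟨h, relativeLatchingObj_hom_ext ?_ fun b ↦ ?_, h₃⟩⟩
    · rw [reassoc_of% @inl_relativeLatchingMap, h₁]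
    · rw [reassoc_of% @relativeLatchingObjι_relativeLatchingMap, h₂]

end Latching

section Matching

variable [HasLimitsOfSize.{w, w} M]
variable {L : MorphismProperty K} [L.IsMultiplicative] {X Y : K ⥤ M} {φ : X ⟶ Y} {c : K}

/-- The projection from the matching object of `X` at `c` to `X_b`. -/
def matchingObjπ (X : K ⥤ M) (b : MatchingCategory L c) : matchingObj L X c ⟶ X.obj b.right :=
  limit.π (matchingForget L c ⋙ X) b

lemma matchingObjπ_w (X : K ⥤ M) {b b' : MatchingCategory L c} (k : b ⟶ b') :
    matchingObjπ X b ≫ X.map k.right = matchingObjπ X b' :=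
  limit.w (matchingForget L c ⋙ X) k

lemma matchingObj_hom_ext {E : M} {f g : E ⟶ matchingObj L X c}
    (h : ∀ b : MatchingCategory L c, f ≫ matchingObjπ X b = g ≫ matchingObjπ X b) : f = g :=
  limit.hom_ext h

lemma exists_matchingObj_lift {E : M} (t : ∀ b : MatchingCategory L c, E ⟶ X.obj b.right)
    (ht : ∀ (b b' : MatchingCategory L c) (k : b ⟶ b'), t b ≫ X.map k.right = t b') :
    ∃ d : E ⟶ matchingObj L X c, ∀ b : MatchingCategory L c, d ≫ matchingObjπ X b = t b :=
  ⟨limit.lift (matchingForget L c ⋙ X)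
    { pt := E
      π := { app := t
             naturality := fun b b' k ↦ (Category.id_comp _).trans (ht b b' k).symm } },
    fun b ↦ limit.lift_π _ b⟩

@[simp]
lemma matchingπ_matchingObjπ (X : K ⥤ M) (b : MatchingCategory L c) :
    matchingπ L X c ≫ matchingObjπ X b = X.map (matchingHom b) :=
  matchingπ_π L X c b

@[simp]
lemma matchingMap_matchingObjπ (φ : X ⟶ Y) (b : MatchingCategory L c) :
    matchingMap L φ c ≫ matchingObjπ Y b = matchingObjπ X b ≫ φ.app b.right :=
  matchingMap_π L φ c b

variable [HasPullbacks M]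

variable (L) in
/-- The object `M_c X ×_{M_c Y} Y_c` for a morphism `φ : X ⟶ Y`. -/
abbrev relativeMatchingObj (φ : X ⟶ Y) (c : K) : M :=
  pullback (matchingMap L φ c) (matchingπ L Y c)

/-- The map from the relative matching object at `c` to `X_b`, for `b` in the matching category. -/
def relativeMatchingObjπ (φ : X ⟶ Y) (b : MatchingCategory L c) :
    relativeMatchingObj L φ c ⟶ X.obj b.right :=
  pullback.fst (matchingMap L φ c) (matchingπ L Y c) ≫ matchingObjπ X b

@[simp]
lemma relativeMatchingMap_snd (φ : X ⟶ Y) (c : K) :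
    relativeMatchingMap L φ c ≫ pullback.snd (matchingMap L φ c) (matchingπ L Y c) = φ.app c :=
  pullback.lift_snd _ _ _

@[simp]
lemma relativeMatchingMap_relativeMatchingObjπ (φ : X ⟶ Y) (b : MatchingCategory L c) :
    relativeMatchingMap L φ c ≫ relativeMatchingObjπ φ b = X.map (matchingHom b) := by
  rw [relativeMatchingObjπ, relativeMatchingMap, pullback.lift_fst_assoc,
    matchingπ_matchingObjπ]

lemma relativeMatchingObj_hom_ext {E : M} {f g : E ⟶ relativeMatchingObj L φ c}
    (h : f ≫ pullback.snd (matchingMap L φ c) (matchingπ L Y c) =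
      g ≫ pullback.snd (matchingMap L φ c) (matchingπ L Y c))
    (h' : ∀ b : MatchingCategory L c,
      f ≫ relativeMatchingObjπ φ b = g ≫ relativeMatchingObjπ φ b) : f = g := by
  refine pullback.hom_ext ?_ h
  apply matchingObj_hom_ext
  intro b
  simpa only [relativeMatchingObjπ, Category.assoc] using h' b

lemma exists_relativeMatchingObj_lift {E : M} (s : E ⟶ Y.obj c)
    (t : ∀ b : MatchingCategory L c, E ⟶ X.obj b.right)
    (ht : ∀ (b b' : MatchingCategory L c) (k : b ⟶ b'), t b ≫ X.map k.right = t b')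
    (hs : ∀ b : MatchingCategory L c, t b ≫ φ.app b.right = s ≫ Y.map (matchingHom b)) :
    ∃ d : E ⟶ relativeMatchingObj L φ c,
      d ≫ pullback.snd (matchingMap L φ c) (matchingπ L Y c) = s ∧
        ∀ b : MatchingCategory L c, d ≫ relativeMatchingObjπ φ b = t b := by
  obtain ⟨d, hd⟩ := exists_matchingObj_lift t ht
  refine ⟨pullback.lift d s ?_, pullback.lift_snd _ _ _, fun b ↦ ?_⟩
  · apply matchingObj_hom_ext
    intro b
    rw [Category.assoc, Category.assoc, matchingπ_matchingObjπ, matchingMap_matchingObjπ,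
      reassoc_of% hd, hs]
  · rw [relativeMatchingObjπ, pullback.lift_fst_assoc, hd]

/-- The lifting property of a relative matching map, in terms of maps into the objects of the
diagrams. -/
lemma hasLiftingProperty_relativeMatchingMap_iff {U V : M} (j : U ⟶ V) :
    HasLiftingProperty j (relativeMatchingMap L φ c) ↔
      ∀ (s : V ⟶ Y.obj c) (t : ∀ b : MatchingCategory L c, V ⟶ X.obj b.right) (u : U ⟶ X.obj c),
        (∀ (b b' : MatchingCategory L c) (k : b ⟶ b'), t b ≫ X.map k.right = t b') →
        (∀ b : MatchingCategory L c, t b ≫ φ.app b.right = s ≫ Y.map (matchingHom b)) →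
        j ≫ s = u ≫ φ.app c →
        (∀ b : MatchingCategory L c, j ≫ t b = u ≫ X.map (matchingHom b)) →
        ∃ h : V ⟶ X.obj c, h ≫ φ.app c = s ∧
          (∀ b : MatchingCategory L c, h ≫ X.map (matchingHom b) = t b) ∧ j ≫ h = u := by
  constructor
  · intro H s t u ht hs hu htu
    obtain ⟨d, hd, hd'⟩ := exists_relativeMatchingObj_lift s t ht hs
    have sq : CommSq u j (relativeMatchingMap L φ c) d := ⟨by
      refine relativeMatchingObj_hom_ext ?_ fun b ↦ ?_
      · rw [Category.assoc, Category.assoc, hd, hu, relativeMatchingMap_snd]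
      · rw [Category.assoc, Category.assoc, hd', htu, relativeMatchingMap_relativeMatchingObjπ]⟩
    refine ⟨sq.lift, ?_, fun b ↦ ?_, sq.fac_left⟩
    · rw [← relativeMatchingMap_snd (L := L), ← Category.assoc, sq.fac_right, hd]
    · rw [← relativeMatchingMap_relativeMatchingObjπ φ, ← Category.assoc, sq.fac_right, hd']
  · intro H
    refine ⟨fun {u d} sq ↦ ?_⟩
    obtain ⟨h, h₁, h₂, h₃⟩ := H (d ≫ pullback.snd _ _) (fun b ↦ d ≫ relativeMatchingObjπ φ b) u
      (fun b b' k ↦ by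
        simp only [relativeMatchingObjπ, Category.assoc, matchingObjπ_w])
      (fun b ↦ by
        simp only [relativeMatchingObjπ, Category.assoc]
        rw [← matchingπ_matchingObjπ, ← pullback.condition_assoc, matchingMap_matchingObjπ])
      (by rw [← Category.assoc, ← sq.w, Category.assoc, relativeMatchingMap_snd])
      (fun b ↦ by
        rw [← Category.assoc, ← sq.w, Category.assoc, relativeMatchingMap_relativeMatchingObjπ])
    refine ⟨⟨h, h₃, relativeMatchingObj_hom_ext ?_ fun b ↦ ?_⟩⟩
    · rw [Category.assoc, relativeMatchingMap_snd, h₁]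
    · rw [Category.assoc, relativeMatchingMap_relativeMatchingObjπ, h₂]

end Matching

end Relative

/-! ### Latching and matching categories of Reedy categories -/

section Reedy

variable {K : Type w} [Category.{w} K] {L R : MorphismProperty K}
  [L.IsMultiplicative] [R.IsMultiplicative]

/-- The object of the latching category at `c` given by a nonidentity map in `R`. -/
def latchingMk {b c : K} (f : b ⟶ c) (hf : R f) (hf' : ¬ MorphismProperty.identities K f) :
    LatchingCategory R c :=
  MorphismProperty.Over.mk R f ⟨hf, hf'⟩

/-- The object of the matching category at `c` given by a nonidentity map in `L`. -/
def matchingMk {b c : K} (f : c ⟶ b) (hf : L f) (hf' : ¬ MorphismProperty.identities K f) :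
    MatchingCategory L c :=
  MorphismProperty.Under.mk L f ⟨hf, hf'⟩

/-- Constructor for morphisms in the latching category. -/
def latchingHomMk {c : K} {b b' : LatchingCategory R c} (k : b.left ⟶ b'.left) (hk : R k)
    (w : k ≫ latchingHom b' = latchingHom b) : b ⟶ b' :=
  MorphismProperty.Over.homMk k w hk

/-- Constructor for morphisms in the matching category. -/
def matchingHomMk {c : K} {b b' : MatchingCategory L c} (k : b.right ⟶ b'.right) (hk : L k)
    (w : matchingHom b ≫ k = matchingHom b') : b ⟶ b' :=
  MorphismProperty.Under.homMk k w hk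

variable {D : Type t} [LinearOrder D] [OrderBot D] [SuccOrder D] [WellFoundedLT D]
  (r : ReedyStructure L R D)

namespace HomotopicalAlgebra.ReedyStructure

lemma latching_deg_lt {c : K} (b : LatchingCategory R c) : r.deg b.left < r.deg c :=
  r.lt₂ (latchingHom b) b.prop.1 b.prop.2

lemma matching_deg_lt {c : K} (b : MatchingCategory L c) : r.deg b.right < r.deg c :=
  r.lt₁ (matchingHom b) b.prop.1 b.prop.2

include r in
-- Maps in `R` do not lower the degree and `latchingHom b` raises it strictly, so the composite has
-- distinct source and target.
lemma not_identities_comp_latchingHom {c : K} (b : LatchingCategory R c) {a : K}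
    (f : a ⟶ b.left) (hf : R f) : ¬ MorphismProperty.identities K (f ≫ latchingHom b) := by
  have h := (r.le₂ f hf).trans_lt (r.latching_deg_lt b)
  generalize f ≫ latchingHom b = g at *
  rintro ⟨⟩
  exact h.ne rfl

include r in
lemma not_identities_matchingHom_comp {c : K} (b : MatchingCategory L c) {a : K}
    (f : b.right ⟶ a) (hf : L f) : ¬ MorphismProperty.identities K (matchingHom b ≫ f) := by
  have h := (r.le₁ f hf).trans_lt (r.matching_deg_lt b)
  generalize matchingHom b ≫ f = g at *
  rintro ⟨⟩
  exact h.ne rfl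

/-- The composition of an object of the latching category with a map in `R`. -/
def latchingComp {c : K} (b : LatchingCategory R c) {a : K} (f : a ⟶ b.left) (hf : R f) :
    LatchingCategory R c :=
  latchingMk (f ≫ latchingHom b) (R.comp_mem _ _ hf b.prop.1)
    (r.not_identities_comp_latchingHom b f hf)

/-- The composition of an object of the matching category with a map in `L`. -/
def matchingComp {c : K} (b : MatchingCategory L c) {a : K} (f : b.right ⟶ a) (hf : L f) :
    MatchingCategory L c :=
  matchingMk (matchingHom b ≫ f) (L.comp_mem _ _ b.prop.1 hf)
    (r.not_identities_matchingHom_comp b f hf)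

/-- The map in the latching category given by a composition. -/
def latchingCompHom {c : K} (b : LatchingCategory R c) {a : K} (f : a ⟶ b.left) (hf : R f) :
    r.latchingComp b f hf ⟶ b :=
  latchingHomMk (b := r.latchingComp b f hf) f hf rfl

/-- The map in the matching category given by a composition. -/
def matchingCompHom {c : K} (b : MatchingCategory L c) {a : K} (f : b.right ⟶ a) (hf : L f) :
    b ⟶ r.matchingComp b f hf :=
  matchingHomMk (b' := r.matchingComp b f hf) f hf rfl

variable {M : Type u} [Category.{v} M]

/-- A family of maps on objects which is compatible with the nonidentity maps in `R` and `L` is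
natural. -/
lemma naturality_of_latching_matching {X Y : K ⥤ M} (S : K → Prop)
    (hS : ∀ b, S b → ∀ a, r.deg a < r.deg b → S a) (h : ∀ b, S b → (X.obj b ⟶ Y.obj b))
    (hR : ∀ c (hc : S c) (b : LatchingCategory R c), X.map (latchingHom b) ≫ h c hc =
      h b.left (hS c hc _ (r.latching_deg_lt b)) ≫ Y.map (latchingHom b))
    (hL : ∀ c (hc : S c) (b : MatchingCategory L c), h c hc ≫ Y.map (matchingHom b) =
      X.map (matchingHom b) ≫ h b.right (hS c hc _ (r.matching_deg_lt b)))
    {b c : K} (hb : S b) (hc : S c) (f : b ⟶ c) : X.map f ≫ h c hc = h b hb ≫ Y.map f := by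
  have hR' : ∀ {b c : K} (hb : S b) (hc : S c) (f : b ⟶ c), R f →
      X.map f ≫ h c hc = h b hb ≫ Y.map f := by
    intro b c hb hc f hf
    by_cases hf' : MorphismProperty.identities K f
    · cases hf'
      simp
    · exact hR c hc (latchingMk f hf hf')
  have hL' : ∀ {b c : K} (hb : S b) (hc : S c) (f : b ⟶ c), L f →
      X.map f ≫ h c hc = h b hb ≫ Y.map f := by
    intro b c hb hc f hf
    by_cases hf' : MorphismProperty.identities K f
    · cases hf'
      simp
    · exact (hL b hb (matchingMk f hf hf')).symm
  -- The intermediate object has degree at most that of `b`, so the factorization does not leave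
  -- `S`.
  obtain ⟨z, l, k, hl, hk, rfl, -⟩ := r.exists_fac f
  have hz : S z := by
    by_cases hl' : MorphismProperty.identities K l
    · cases hl'
      exact hb
    · exact hS b hb z (r.lt₁ l hl hl')
  rw [X.map_comp, Category.assoc, hR' hz hc k hk, ← Category.assoc, hL' hb hz l hl, Category.assoc,
    ← Y.map_comp]

/-! ### Lifting problems between diagrams, solved degree by degree -/

section Lifting

variable [HasLimitsOfSize.{w, w} M] [HasColimitsOfSize.{w, w} M] [HasPushouts M] [HasPullbacks M]

include r in
/-- A morphism of diagrams has the left lifting property with respect to another one if its relative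
latching maps have the left lifting property with respect to the relative matching maps of the
other one. -/
theorem hasLiftingProperty_of_relative {X Y E B : K ⥤ M} (i : X ⟶ Y) (p : E ⟶ B)
    (H : ∀ c, HasLiftingProperty (relativeLatchingMap R i c) (relativeMatchingMap L p c)) :
    HasLiftingProperty i p := by
  refine ⟨fun {a b} sq ↦ ?_⟩
  have hw : ∀ c, a.app c ≫ p.app c = i.app c ≫ b.app c := fun c ↦ NatTrans.congr_app sq.w c
  obtain ⟨g, hg⟩ := exists_dependent_choice' r.deg (fun c ↦ Y.obj c ⟶ E.obj c)
    (fun c g x ↦ i.app c ≫ x = a.app c ∧ x ≫ p.app c = b.app c ∧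
      (∀ k : LatchingCategory R c, Y.map (latchingHom k) ≫ x =
        g k.left (r.latching_deg_lt k) ≫ E.map (latchingHom k)) ∧
      ∀ k : MatchingCategory L c, x ≫ E.map (matchingHom k) =
        Y.map (matchingHom k) ≫ g k.right (r.matching_deg_lt k)) (by
    intro c g hg
    -- The components chosen so far form a natural transformation on the full subcategory of objects
    -- of degree less than that of `c`.
    have nat {b b' : K} (hb : r.deg b < r.deg c) (hb' : r.deg b' < r.deg c) (f : b ⟶ b') :
        Y.map f ≫ g b' hb' = g b hb ≫ E.map f :=
      r.naturality_of_latching_matching (fun b ↦ r.deg b < r.deg c)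
        (fun b hb a ha ↦ ha.trans hb) g (fun b hb k ↦ (hg b hb).2.2.1 k)
        (fun b hb k ↦ (hg b hb).2.2.2 k) hb hb' f
    obtain ⟨d, hd, hd'⟩ := exists_relativeLatchingObj_desc (R := R) (φ := i) (a.app c)
      (fun k ↦ g k.left (r.latching_deg_lt k) ≫ E.map (latchingHom k))
      (fun k k' m ↦ by
        rw [← Category.assoc, nat (r.latching_deg_lt k), Category.assoc, ← E.map_comp,
          latchingHom_w])
      (fun k ↦ by
        rw [← Category.assoc, (hg k.left (r.latching_deg_lt k)).1, NatTrans.naturality])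
    obtain ⟨e, he, he'⟩ := exists_relativeMatchingObj_lift (L := L) (φ := p) (b.app c)
      (fun k ↦ Y.map (matchingHom k) ≫ g k.right (r.matching_deg_lt k))
      (fun k k' m ↦ by
        rw [Category.assoc, ← nat _ (r.matching_deg_lt k'), ← Category.assoc, ← Y.map_comp,
          matchingHom_w])
      (fun k ↦ by
        rw [Category.assoc, (hg k.right (r.matching_deg_lt k)).2.1, NatTrans.naturality])
    -- The known components determine the map `d` out of the relative latching object and the map
    -- `e` into the relative matching object. A diagonal of this square is exactly an admissible
    -- component at `c`.
    have sq' : CommSq d (relativeLatchingMap R i c) (relativeMatchingMap L p c) e := by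
      refine ⟨relativeLatchingObj_hom_ext ?_ fun k ↦ ?_⟩
      · rw [← Category.assoc, hd, reassoc_of% @inl_relativeLatchingMap]
        refine relativeMatchingObj_hom_ext ?_ fun m ↦ ?_
        · rw [Category.assoc, relativeMatchingMap_snd, Category.assoc, he, hw]
        · rw [Category.assoc, relativeMatchingMap_relativeMatchingObjπ, Category.assoc, he',
            ← NatTrans.naturality_assoc, (hg m.right (r.matching_deg_lt m)).1, NatTrans.naturality]
      · rw [← Category.assoc, hd', reassoc_of% @relativeLatchingObjι_relativeLatchingMap]
        refine relativeMatchingObj_hom_ext ?_ fun m ↦ ?_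
        · rw [Category.assoc, relativeMatchingMap_snd, Category.assoc, Category.assoc, he,
            NatTrans.naturality, ← Category.assoc, (hg k.left (r.latching_deg_lt k)).2.1,
            NatTrans.naturality]
        -- The raising map into `c` followed by the lowering map out of `c` joins objects of lower
        -- degree, where `nat` applies.
        · rw [Category.assoc, relativeMatchingMap_relativeMatchingObjπ, Category.assoc,
            Category.assoc, he', ← E.map_comp, ← Category.assoc, ← Y.map_comp, nat]
    have := H c
    refine ⟨sq'.lift, ?_, ?_, fun k ↦ ?_, fun k ↦ ?_⟩
    · rw [← inl_relativeLatchingMap (R := R), Category.assoc, sq'.fac_left, hd]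
    · rw [← relativeMatchingMap_snd (L := L), ← Category.assoc, sq'.fac_right, he]
    · rw [← relativeLatchingObjι_relativeLatchingMap i, Category.assoc, sq'.fac_left, hd']
    · rw [← relativeMatchingMap_relativeMatchingObjπ p, ← Category.assoc, sq'.fac_right, he'])
  refine ⟨⟨{ app := g, naturality := fun b c f ↦ ?_ }, ?_, ?_⟩⟩
  · exact r.naturality_of_latching_matching (fun _ ↦ True) (fun _ _ _ _ ↦ trivial)
      (fun b _ ↦ g b) (fun b _ k ↦ (hg b).2.2.1 k) (fun b _ k ↦ (hg b).2.2.2 k) trivial trivial f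
  · ext c
    exact (hg c).1
  · ext c
    exact (hg c).2.1

end Lifting

/-! ### Lifting properties of maps of latching objects -/

section LatchingMap

variable [HasColimitsOfSize.{w, w} M] [HasPushouts M]

/-- The map between latching objects at `c` has the left lifting property with respect to `q` if the
relative latching maps in lower degrees do. -/
theorem hasLiftingProperty_latchingMap {X Y : K ⥤ M} (i : X ⟶ Y) (c : K) {E B : M} (q : E ⟶ B)
    (H : ∀ b, r.deg b < r.deg c → HasLiftingProperty (relativeLatchingMap R i b) q) :
    HasLiftingProperty (latchingMap R i c) q := by
  refine ⟨fun {d e} sq ↦ ?_⟩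
  -- Composition with `latchingHom k` sends the latching category at `k.left` into the one at `c`,
  -- lowering the degree. So a lift on `L_c Y` can be chosen one object `k` at a time, the extension
  -- over `k` being governed by the relative latching map at `k.left`.
  have deg_lt {k : LatchingCategory R c} (a : LatchingCategory R k.left) :
      r.deg (r.latchingComp k (latchingHom a) a.prop.1).left < r.deg k.left := r.latching_deg_lt a
  obtain ⟨g, hg⟩ := exists_dependent_choice' (fun k : LatchingCategory R c ↦ r.deg k.left)
    (fun k ↦ Y.obj k.left ⟶ E)
    (fun k g x ↦ i.app k.left ≫ x = latchingObjι X k ≫ d ∧ x ≫ q = latchingObjι Y k ≫ e ∧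
      ∀ a : LatchingCategory R k.left, Y.map (latchingHom a) ≫ x =
        g (r.latchingComp k (latchingHom a) a.prop.1) (deg_lt a)) (by
    intro k g hg
    have congr {b : K} (hb : r.deg b < r.deg k.left) {f f' : b ⟶ c} (h : f = f') (hf hf' hi hi') :
        g (latchingMk f hf hi) hb = g (latchingMk f' hf' hi') hb := by
      subst h
      rfl
    -- Morphisms between objects of a latching category may be identities, while the inductive
    -- condition only concerns nonidentity maps; the identity case is separate.
    have key {b b' : K} (f : b ⟶ b') (hf : R f) (m : b' ⟶ k.left) (hm : R m)
        (hb : r.deg b < r.deg k.left) (hb' : r.deg b' < r.deg k.left) :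
        Y.map f ≫ g (r.latchingComp k m hm) hb' =
          g (r.latchingComp k (f ≫ m) (R.comp_mem _ _ hf hm)) hb := by
      by_cases hf' : MorphismProperty.identities K f
      · cases hf'
        refine ((congrArg (· ≫ _) (Y.map_id b)).trans (Category.id_comp _)).trans ?_
        exact congr _ (by rw [Category.id_comp]) _ _ _ _
      · exact ((hg (r.latchingComp k m hm) hb').2.2 (latchingMk f hf hf')).trans
          (congr _ (Category.assoc _ _ _).symm _ _ _ _)
    obtain ⟨h, h₁, h₂, h₃⟩ := (hasLiftingProperty_relativeLatchingMap_iff q).1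
      (H k.left (r.latching_deg_lt k)) (latchingObjι X k ≫ d)
      (fun a ↦ g (r.latchingComp k (latchingHom a) a.prop.1) (deg_lt a)) (latchingObjι Y k ≫ e)
      (fun a a' m ↦ by
        refine (key m.left m.prop_hom_left (latchingHom a') a'.prop.1 (r.latching_deg_lt a)
          (r.latching_deg_lt a')).trans (congr _ ?_ _ _ _ _)
        rw [latchingHom_w])
      (fun a ↦ by
        refine (hg (r.latchingComp k (latchingHom a) a.prop.1) (deg_lt a)).1.trans ?_
        rw [← Category.assoc]
        congr 1
        exact (latchingObjι_w X (r.latchingCompHom k (latchingHom a) a.prop.1)).symm)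
      (by rw [Category.assoc, sq.w, reassoc_of% @latchingObjι_latchingMap])
      (fun a ↦ by
        refine (hg (r.latchingComp k (latchingHom a) a.prop.1) (deg_lt a)).2.1.trans ?_
        rw [← Category.assoc]
        congr 1
        exact (latchingObjι_w Y (r.latchingCompHom k (latchingHom a) a.prop.1)).symm)
    exact ⟨h, h₁, h₃, h₂⟩)
  obtain ⟨l, hl⟩ := exists_latchingObj_desc (X := Y) g (fun k k' m ↦ by
    have congr {b : K} {f f' : b ⟶ c} (h : f = f') (hf hf' hi hi') :
        g (latchingMk f hf hi) = g (latchingMk f' hf' hi') := by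
      subst h
      rfl
    have key {b b' : K} (f : b ⟶ b') (hf : R f) (m : b' ⟶ c) (hm : R m) (hb hb') :
        Y.map f ≫ g (latchingMk m hm hb') =
          g (latchingMk (f ≫ m) (R.comp_mem _ _ hf hm) hb) := by
      by_cases hf' : MorphismProperty.identities K f
      · cases hf'
        refine ((congrArg (· ≫ _) (Y.map_id b)).trans (Category.id_comp _)).trans ?_
        exact congr (by rw [Category.id_comp]) _ _ _ _
      · exact (hg (latchingMk m hm hb')).2.2 (latchingMk f hf hf')
    refine (key m.left m.prop_hom_left (latchingHom k') k'.prop.1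
      (r.not_identities_comp_latchingHom k' _ m.prop_hom_left) k'.prop.2).trans
        (congr (latchingHom_w m) _ k.prop.1 _ k.prop.2))
  refine ⟨⟨l, latchingObj_hom_ext fun k ↦ ?_, latchingObj_hom_ext fun k ↦ ?_⟩⟩
  · rw [reassoc_of% @latchingObjι_latchingMap, hl, (hg k).1]
  · rw [← Category.assoc, hl, (hg k).2.1]

end LatchingMap

/-! ### Lifting properties of maps of matching objects -/

section MatchingMap

variable [HasLimitsOfSize.{w, w} M] [HasPullbacks M]

/-- The map between matching objects at `c` has the right lifting property with respect to `j` if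
the relative matching maps in lower degrees do. -/
theorem hasLiftingProperty_matchingMap {X Y : K ⥤ M} (p : X ⟶ Y) (c : K) {U V : M} (j : U ⟶ V)
    (H : ∀ b, r.deg b < r.deg c → HasLiftingProperty j (relativeMatchingMap L p b)) :
    HasLiftingProperty j (matchingMap L p c) := by
  refine ⟨fun {d e} sq ↦ ?_⟩
  have deg_lt {k : MatchingCategory L c} (a : MatchingCategory L k.right) :
      r.deg (r.matchingComp k (matchingHom a) a.prop.1).right < r.deg k.right :=
    r.matching_deg_lt a
  obtain ⟨g, hg⟩ := exists_dependent_choice' (fun k : MatchingCategory L c ↦ r.deg k.right)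
    (fun k ↦ V ⟶ X.obj k.right)
    (fun k g x ↦ j ≫ x = d ≫ matchingObjπ X k ∧ x ≫ p.app k.right = e ≫ matchingObjπ Y k ∧
      ∀ a : MatchingCategory L k.right, x ≫ X.map (matchingHom a) =
        g (r.matchingComp k (matchingHom a) a.prop.1) (deg_lt a)) (by
    intro k g hg
    have congr {b : K} (hb : r.deg b < r.deg k.right) {f f' : c ⟶ b} (h : f = f')
        (hf hf' hi hi') : g (matchingMk f hf hi) hb = g (matchingMk f' hf' hi') hb := by
      subst h
      rfl
    have key {b b' : K} (f : b ⟶ b') (hf : L f) (m : k.right ⟶ b) (hm : L m)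
        (hb : r.deg b < r.deg k.right) (hb' : r.deg b' < r.deg k.right) :
        g (r.matchingComp k m hm) hb ≫ X.map f =
          g (r.matchingComp k (m ≫ f) (L.comp_mem _ _ hm hf)) hb' := by
      by_cases hf' : MorphismProperty.identities K f
      · cases hf'
        refine ((congrArg (_ ≫ ·) (X.map_id b)).trans (Category.comp_id _)).trans ?_
        exact congr _ (by rw [Category.comp_id]) _ _ _ _
      · exact ((hg (r.matchingComp k m hm) hb).2.2 (matchingMk f hf hf')).trans
          (congr _ (Category.assoc _ _ _) _ _ _ _)
    obtain ⟨h, h₁, h₂, h₃⟩ := (hasLiftingProperty_relativeMatchingMap_iff j).1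
      (H k.right (r.matching_deg_lt k)) (e ≫ matchingObjπ Y k)
      (fun a ↦ g (r.matchingComp k (matchingHom a) a.prop.1) (deg_lt a)) (d ≫ matchingObjπ X k)
      (fun a a' m ↦ by
        refine (key m.right m.prop_hom_right (matchingHom a) a.prop.1 (r.matching_deg_lt a)
          (r.matching_deg_lt a')).trans (congr _ ?_ _ _ _ _)
        rw [matchingHom_w])
      (fun a ↦ by
        refine (hg (r.matchingComp k (matchingHom a) a.prop.1) (deg_lt a)).2.1.trans ?_
        rw [Category.assoc]
        congr 1
        exact (matchingObjπ_w Y (r.matchingCompHom k (matchingHom a) a.prop.1)).symm)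
      (by rw [← Category.assoc, ← sq.w, Category.assoc, matchingMap_matchingObjπ, Category.assoc])
      (fun a ↦ by
        refine (hg (r.matchingComp k (matchingHom a) a.prop.1) (deg_lt a)).1.trans ?_
        rw [Category.assoc]
        congr 1
        exact (matchingObjπ_w X (r.matchingCompHom k (matchingHom a) a.prop.1)).symm)
    exact ⟨h, h₃, h₁, h₂⟩)
  obtain ⟨l, hl⟩ := exists_matchingObj_lift (X := X) g (fun k k' m ↦ by
    have congr {b : K} {f f' : c ⟶ b} (h : f = f') (hf hf' hi hi') :
        g (matchingMk f hf hi) = g (matchingMk f' hf' hi') := by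
      subst h
      rfl
    have key {b b' : K} (f : b ⟶ b') (hf : L f) (m : c ⟶ b) (hm : L m) (hb hb') :
        g (matchingMk m hm hb) ≫ X.map f =
          g (matchingMk (m ≫ f) (L.comp_mem _ _ hm hf) hb') := by
      by_cases hf' : MorphismProperty.identities K f
      · cases hf'
        refine ((congrArg (_ ≫ ·) (X.map_id b)).trans (Category.comp_id _)).trans ?_
        exact congr (by rw [Category.comp_id]) _ _ _ _
      · exact (hg (matchingMk m hm hb)).2.2 (matchingMk f hf hf')
    refine (key m.right m.prop_hom_right (matchingHom k) k.prop.1 k.prop.2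
      (r.not_identities_matchingHom_comp k _ m.prop_hom_right)).trans
        (congr (matchingHom_w m) _ k'.prop.1 _ k'.prop.2))
  refine ⟨⟨l, matchingObj_hom_ext fun k ↦ ?_, matchingObj_hom_ext fun k ↦ ?_⟩⟩
  · rw [Category.assoc, hl, (hg k).1]
  · rw [Category.assoc, matchingMap_matchingObjπ, ← Category.assoc, hl, (hg k).2.1]

end MatchingMap

end HomotopicalAlgebra.ReedyStructure

end Reedy

/-! ### Relative colimits and limits -/

section RelativeLimits

variable {J : Type w} [Category.{w} J] {M : Type u} [Category.{v} M]

/-- The existence of the pushout of the vertex of a cocone of `F` along the map from the colimit of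
`F` to the colimit of `G`, described by its universal property. -/
lemma exists_relative_colimit [HasColimitsOfSize.{w, w} M] [HasPushouts M] {F G : J ⥤ M}
    (α : F ⟶ G) (c : Cocone F) :
    ∃ (U : M) (i : c.pt ⟶ U) (e : ∀ j, G.obj j ⟶ U),
      (∀ ⦃j j'⦄ (m : j ⟶ j'), G.map m ≫ e j' = e j) ∧ (∀ j, α.app j ≫ e j = c.ι.app j ≫ i) ∧
      (∀ ⦃E : M⦄ (s : c.pt ⟶ E) (t : ∀ j, G.obj j ⟶ E),
        (∀ ⦃j j'⦄ (m : j ⟶ j'), G.map m ≫ t j' = t j) → (∀ j, α.app j ≫ t j = c.ι.app j ≫ s) →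
        ∃ d : U ⟶ E, i ≫ d = s ∧ ∀ j, e j ≫ d = t j) ∧
      ∀ ⦃E : M⦄ (d d' : U ⟶ E), i ≫ d = i ≫ d' → (∀ j, e j ≫ d = e j ≫ d') → d = d' := by
  refine ⟨pushout (colimit.desc F c) (colimMap α), pushout.inl _ _,
    fun j ↦ colimit.ι G j ≫ pushout.inr _ _, fun j j' m ↦ ?_, fun j ↦ ?_, fun E s t ht hs ↦ ?_,
    fun E d d' h h' ↦ ?_⟩
  · rw [← Category.assoc, colimit.w]
  · rw [← ι_colimMap_assoc, ← pushout.condition, colimit.ι_desc_assoc]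
  · refine ⟨pushout.desc s (colimit.desc G ⟨E, ⟨t, fun j j' m ↦ ?_⟩⟩) ?_, ?_, fun j ↦ ?_⟩
    · exact (ht m).trans (Category.comp_id _).symm
    · apply colimit.hom_ext
      intro j
      rw [colimit.ι_desc_assoc, ι_colimMap_assoc, colimit.ι_desc, hs]
    · rw [pushout.inl_desc]
    · rw [Category.assoc, pushout.inr_desc, colimit.ι_desc]
  · apply pushout.hom_ext h
    apply colimit.hom_ext
    intro j
    simpa only [Category.assoc] using h' j

/-- The existence of the pullback of the vertex of a cone of `F` along the map from the limit of
`G` to the limit of `F`, described by its universal property. -/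
lemma exists_relative_limit [HasLimitsOfSize.{w, w} M] [HasPullbacks M] {F G : J ⥤ M}
    (α : G ⟶ F) (c : Cone F) :
    ∃ (U : M) (i : U ⟶ c.pt) (e : ∀ j, U ⟶ G.obj j),
      (∀ ⦃j j'⦄ (m : j ⟶ j'), e j ≫ G.map m = e j') ∧ (∀ j, e j ≫ α.app j = i ≫ c.π.app j) ∧
      (∀ ⦃E : M⦄ (s : E ⟶ c.pt) (t : ∀ j, E ⟶ G.obj j),
        (∀ ⦃j j'⦄ (m : j ⟶ j'), t j ≫ G.map m = t j') → (∀ j, t j ≫ α.app j = s ≫ c.π.app j) →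
        ∃ d : E ⟶ U, d ≫ i = s ∧ ∀ j, d ≫ e j = t j) ∧
      ∀ ⦃E : M⦄ (d d' : E ⟶ U), d ≫ i = d' ≫ i → (∀ j, d ≫ e j = d' ≫ e j) → d = d' := by
  refine ⟨pullback (limMap α) (limit.lift F c), pullback.snd _ _,
    fun j ↦ pullback.fst _ _ ≫ limit.π G j, fun j j' m ↦ ?_, fun j ↦ ?_, fun E s t ht hs ↦ ?_,
    fun E d d' h h' ↦ ?_⟩
  · rw [Category.assoc, limit.w]
  · rw [Category.assoc, ← limMap_π, pullback.condition_assoc, limit.lift_π]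
  · refine ⟨pullback.lift (limit.lift G ⟨E, ⟨t, fun j j' m ↦ ?_⟩⟩) s ?_, ?_, fun j ↦ ?_⟩
    · exact (Category.id_comp _).trans (ht m).symm
    · apply limit.hom_ext
      intro j
      rw [Category.assoc, Category.assoc, limMap_π, limit.lift_π_assoc, limit.lift_π, hs]
    · rw [pullback.lift_snd]
    · rw [pullback.lift_fst_assoc, limit.lift_π]
  · refine pullback.hom_ext ?_ h
    apply limit.hom_ext
    intro j
    simpa only [Category.assoc] using h' j

end RelativeLimits

/-! ### The Reedy factorization -/

namespace HomotopicalAlgebra.ReedyStructure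

variable {K : Type w} [Category.{w} K] {L R : MorphismProperty K}
  [L.IsMultiplicative] [R.IsMultiplicative]
  {D : Type t} [LinearOrder D] [OrderBot D] [SuccOrder D] [WellFoundedLT D]
  (r : ReedyStructure L R D) {M : Type u} [Category.{v} M] (X Y : K ⥤ M)

/-- The data extending a diagram defined in degrees less than that of `c`, with values `g`, by the
value `Z` at `c`, together with a factorization of a map from `X` to `Y`. -/
structure Cell (c : K) (g : ∀ b, r.deg b < r.deg c → M) (Z : M) where
  /-- The action of raising maps. -/
  inn (k : LatchingCategory R c) : g k.left (r.latching_deg_lt k) ⟶ Z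
  /-- The action of lowering maps. -/
  out (k : MatchingCategory L c) : Z ⟶ g k.right (r.matching_deg_lt k)
  /-- The first map of the factorization. -/
  ix : X.obj c ⟶ Z
  /-- The second map of the factorization. -/
  py : Z ⟶ Y.obj c

/-- A family of values and cells on a set `S` of objects which is closed under passing to objects
of lower degree. -/
structure CellFamily where
  /-- The set of objects. -/
  S : K → Prop
  closed : ∀ b, S b → ∀ a, r.deg a < r.deg b → S a
  /-- The values. -/
  obj : ∀ b, S b → M
  /-- The cells. -/
  cell : ∀ b (h : S b), r.Cell X Y b (fun a ha ↦ obj a (closed b h a ha)) (obj b h)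

namespace CellFamily

variable {r X Y} (F : r.CellFamily X Y)

open Classical in
/-- The action of the maps in `R`. -/
def mapR {b c : K} (hb : F.S b) (hc : F.S c) (f : b ⟶ c) (hf : R f) : F.obj b hb ⟶ F.obj c hc :=
  -- A cell only records nonidentity maps, as these are the objects of the latching category;
  -- identities have to be supplied by hand.
  if h : MorphismProperty.identities K f then eqToHom (by cases h; rfl)
  else (F.cell c hc).inn (latchingMk f hf h)

open Classical in
/-- The action of the maps in `L`. -/
def mapL {b c : K} (hb : F.S b) (hc : F.S c) (f : b ⟶ c) (hf : L f) : F.obj b hb ⟶ F.obj c hc :=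
  if h : MorphismProperty.identities K f then eqToHom (by cases h; rfl)
  else (F.cell b hb).out (matchingMk f hf h)

lemma mapR_id {b : K} (hb : F.S b) (h : R (𝟙 b)) : F.mapR hb hb (𝟙 b) h = 𝟙 _ :=
  dif_pos ⟨b⟩

lemma mapL_id {b : K} (hb : F.S b) (h : L (𝟙 b)) : F.mapL hb hb (𝟙 b) h = 𝟙 _ :=
  dif_pos ⟨b⟩

lemma mapR_latchingHom {c : K} (k : LatchingCategory R c) (hk : F.S k.left) (hc : F.S c) :
    F.mapR hk hc (latchingHom k) k.prop.1 = (F.cell c hc).inn k :=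
  dif_neg k.prop.2

lemma mapL_matchingHom {c : K} (k : MatchingCategory L c) (hc : F.S c) (hk : F.S k.right) :
    F.mapL hc hk (matchingHom k) k.prop.1 = (F.cell c hc).out k :=
  dif_neg k.prop.2

lemma mapR_congr {b c : K} (hb : F.S b) (hc : F.S c) {f f' : b ⟶ c} (h : f = f') (hf : R f)
    (hf' : R f') : F.mapR hb hc f hf = F.mapR hb hc f' hf' := by
  subst h
  rfl

lemma mapL_congr {b c : K} (hb : F.S b) (hc : F.S c) {f f' : b ⟶ c} (h : f = f') (hf : L f)
    (hf' : L f') : F.mapL hb hc f hf = F.mapL hb hc f' hf' := by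
  subst h
  rfl

lemma mem_of_prop {b c : K} (hb : F.S b) (f : b ⟶ c) (hf : L f) : F.S c := by
  by_cases h : MorphismProperty.identities K f
  · cases h
    exact hb
  · exact F.closed b hb c (r.lt₁ f hf h)

/-- The action of an arbitrary map. -/
def map {b c : K} (hb : F.S b) (hc : F.S c) (f : b ⟶ c) : F.obj b hb ⟶ F.obj c hc :=
  F.mapL hb (F.mem_of_prop hb _ (r.mapFactorizationData f).hi) (r.mapFactorizationData f).i
      (r.mapFactorizationData f).hi ≫
    F.mapR (F.mem_of_prop hb _ (r.mapFactorizationData f).hi) hc (r.mapFactorizationData f).p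
      (r.mapFactorizationData f).hp

/-- By uniqueness of Reedy factorizations, the chosen factorization in `map` may be replaced by any
other one. -/
lemma map_eq {b z c : K} (hb : F.S b) (hz : F.S z) (hc : F.S c) (l : b ⟶ z) (hl : L l) (k : z ⟶ c)
    (hk : R k) : F.map hb hc (l ≫ k) = F.mapL hb hz l hl ≫ F.mapR hz hc k hk := by
  have (fac : L.MapFactorizationData R (l ≫ k)) :
      F.map hb hc (l ≫ k) = F.mapL hb (F.mem_of_prop hb _ fac.hi) fac.i fac.hi ≫
        F.mapR (F.mem_of_prop hb _ fac.hi) hc fac.p fac.hp := by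
    have := r.subsingleton_mapFactorizationData (l ≫ k)
    rw [Subsingleton.elim fac (r.mapFactorizationData (l ≫ k))]
    rfl
  exact this (MorphismProperty.MapFactorizationData.mk z l k rfl hl hk)

lemma map_eq_mapR {b c : K} (hb : F.S b) (hc : F.S c) (f : b ⟶ c) (hf : R f) :
    F.map hb hc f = F.mapR hb hc f hf := by
  have := F.map_eq hb hb hc (𝟙 b) (L.id_mem b) f hf
  rwa [mapL_id, Category.id_comp, Category.id_comp] at this

lemma map_eq_mapL {b c : K} (hb : F.S b) (hc : F.S c) (f : b ⟶ c) (hf : L f) :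
    F.map hb hc f = F.mapL hb hc f hf := by
  have := F.map_eq hb hc hc f hf (𝟙 c) (R.id_mem c)
  rwa [mapR_id, Category.comp_id, Category.comp_id] at this

end CellFamily

variable {r X Y}

/-- The conditions on a cell at `c` with respect to a family in lower degrees: it makes the extended
family a diagram with a factorization of `φ`, and the relative latching and matching maps at `c`
of the two maps of the factorization satisfy lifting properties. -/
structure Cell.IsGood (φ : X ⟶ Y) (W₁ W₂ : MorphismProperty M) (F : r.CellFamily X Y) {c : K}
    (hF : ∀ b, r.deg b < r.deg c → F.S b) {Z : M}
    (e : r.Cell X Y c (fun b hb ↦ F.obj b (hF b hb)) Z) : Prop where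
  inn_w {k k' : LatchingCategory R c} (m : k ⟶ k') :
    F.mapR (hF _ (r.latching_deg_lt k)) (hF _ (r.latching_deg_lt k')) m.left m.prop_hom_left ≫
      e.inn k' = e.inn k
  out_w {k k' : MatchingCategory L c} (m : k ⟶ k') :
    e.out k ≫ F.mapL (hF _ (r.matching_deg_lt k)) (hF _ (r.matching_deg_lt k')) m.right
      m.prop_hom_right = e.out k'
  inn_out (k : LatchingCategory R c) (k' : MatchingCategory L c) :
    e.inn k ≫ e.out k' = F.map (hF _ (r.latching_deg_lt k)) (hF _ (r.matching_deg_lt k'))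
      (latchingHom k ≫ matchingHom k')
  fac : e.ix ≫ e.py = φ.app c
  ix_inn (k : LatchingCategory R c) :
    (F.cell _ (hF _ (r.latching_deg_lt k))).ix ≫ e.inn k = X.map (latchingHom k) ≫ e.ix
  ix_out (k : MatchingCategory L c) :
    e.ix ≫ e.out k = X.map (matchingHom k) ≫ (F.cell _ (hF _ (r.matching_deg_lt k))).ix
  inn_py (k : LatchingCategory R c) :
    e.inn k ≫ e.py = (F.cell _ (hF _ (r.latching_deg_lt k))).py ≫ Y.map (latchingHom k)
  out_py (k : MatchingCategory L c) :
    e.out k ≫ (F.cell _ (hF _ (r.matching_deg_lt k))).py = e.py ≫ Y.map (matchingHom k)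
  -- As `Z` is not yet the value of a functor at `c`, its relative latching map is not available;
  -- the lifting property is stated in the unpacked form of
  -- `hasLiftingProperty_relativeLatchingMap_iff`.
  latching {E B : M} (q : E ⟶ B) (hq : W₂ q) (s : X.obj c ⟶ E)
    (t : ∀ k : LatchingCategory R c, F.obj k.left (hF _ (r.latching_deg_lt k)) ⟶ E) (v : Z ⟶ B)
    (ht : ∀ ⦃k k' : LatchingCategory R c⦄ (m : k ⟶ k'),
      F.mapR (hF _ (r.latching_deg_lt k)) (hF _ (r.latching_deg_lt k')) m.left m.prop_hom_left ≫
        t k' = t k)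
    (hs : ∀ k : LatchingCategory R c,
      (F.cell _ (hF _ (r.latching_deg_lt k))).ix ≫ t k = X.map (latchingHom k) ≫ s)
    (hv : s ≫ q = e.ix ≫ v) (htv : ∀ k, t k ≫ q = e.inn k ≫ v) :
    ∃ h : Z ⟶ E, e.ix ≫ h = s ∧ (∀ k, e.inn k ≫ h = t k) ∧ h ≫ q = v
  matching {U V : M} (j : U ⟶ V) (hj : W₁ j) (s : V ⟶ Y.obj c)
    (t : ∀ k : MatchingCategory L c, V ⟶ F.obj k.right (hF _ (r.matching_deg_lt k))) (u : U ⟶ Z)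
    (ht : ∀ ⦃k k' : MatchingCategory L c⦄ (m : k ⟶ k'),
      t k ≫ F.mapL (hF _ (r.matching_deg_lt k)) (hF _ (r.matching_deg_lt k')) m.right
        m.prop_hom_right = t k')
    (hs : ∀ k : MatchingCategory L c,
      t k ≫ (F.cell _ (hF _ (r.matching_deg_lt k))).py = s ≫ Y.map (matchingHom k))
    (hu : j ≫ s = u ≫ e.py) (htu : ∀ k, j ≫ t k = u ≫ e.out k) :
    ∃ h : V ⟶ Z, h ≫ e.py = s ∧ (∀ k, h ≫ e.out k = t k) ∧ j ≫ h = u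

/-- A family of good cells. -/
def CellFamily.IsGood (φ : X ⟶ Y) (W₁ W₂ : MorphismProperty M) (F : r.CellFamily X Y) : Prop :=
  ∀ c (hc : F.S c), (F.cell c hc).IsGood φ W₁ W₂ F (F.closed c hc)

namespace CellFamily

variable {φ : X ⟶ Y} {W₁ W₂ : MorphismProperty M} {F : r.CellFamily X Y} (hF : F.IsGood φ W₁ W₂)

include hF

/-- If `g` is not an identity, then neither is `f ≫ g`, and `f` is a morphism between the two in the
latching category at `c`, so the relation is an instance of `inn_w`. -/
lemma mapR_comp {a b c : K} (ha : F.S a) (hb : F.S b) (hc : F.S c) (f : a ⟶ b) (hf : R f)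
    (g : b ⟶ c) (hg : R g) :
    F.mapR ha hb f hf ≫ F.mapR hb hc g hg = F.mapR ha hc (f ≫ g) (R.comp_mem _ _ hf hg) := by
  by_cases hg' : MorphismProperty.identities K g
  · cases hg'
    rw [mapR_id, Category.comp_id]
    exact F.mapR_congr _ _ (Category.comp_id f).symm _ _
  · let k := latchingMk g hg hg'
    let k' := r.latchingComp k f hf
    exact (congrArg (F.mapR ha hb f hf ≫ ·) (F.mapR_latchingHom k hb hc)).trans
      (((hF c hc).inn_w (r.latchingCompHom k f hf)).trans (F.mapR_latchingHom k' ha hc).symm)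

lemma mapL_comp {a b c : K} (ha : F.S a) (hb : F.S b) (hc : F.S c) (f : a ⟶ b) (hf : L f)
    (g : b ⟶ c) (hg : L g) :
    F.mapL ha hb f hf ≫ F.mapL hb hc g hg = F.mapL ha hc (f ≫ g) (L.comp_mem _ _ hf hg) := by
  by_cases hf' : MorphismProperty.identities K f
  · cases hf'
    rw [mapL_id, Category.id_comp]
    exact F.mapL_congr _ _ (Category.id_comp g).symm _ _
  · let k := matchingMk f hf hf'
    let k' := r.matchingComp k g hg
    exact (congrArg (· ≫ F.mapL hb hc g hg) (F.mapL_matchingHom k ha hb)).trans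
      (((hF a ha).out_w (r.matchingCompHom k g hg)).trans (F.mapL_matchingHom k' ha hc).symm)

lemma mapR_mapL {a b c : K} (ha : F.S a) (hb : F.S b) (hc : F.S c) (f : a ⟶ b) (hf : R f)
    (g : b ⟶ c) (hg : L g) : F.mapR ha hb f hf ≫ F.mapL hb hc g hg = F.map ha hc (f ≫ g) := by
  by_cases hf' : MorphismProperty.identities K f
  · cases hf'
    rw [mapR_id, Category.id_comp, ← map_eq_mapL]
    congr 1
    exact (Category.id_comp g).symm
  by_cases hg' : MorphismProperty.identities K g
  · cases hg'
    rw [mapL_id, Category.comp_id, ← map_eq_mapR]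
    congr 1
    exact (Category.comp_id f).symm
  let k := latchingMk f hf hf'
  let k' := matchingMk g hg hg'
  exact (congrArg₂ (· ≫ ·) (F.mapR_latchingHom k ha hb) (F.mapL_matchingHom k' hb hc)).trans
    ((hF b hb).inn_out k k')

/-- Writing `f = l₁ ≫ k₁` and `g = l₂ ≫ k₂`, the middle part `k₁ ≫ l₂` is refactored as `l₃ ≫ k₃`.
The cell condition `inn_out`, through `mapR_mapL`, says that the values respect this exchange; the
rest is functoriality on `L` and on `R` separately. -/
lemma map_comp {a b c : K} (ha : F.S a) (hb : F.S b) (hc : F.S c) (f : a ⟶ b) (g : b ⟶ c) :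
    F.map ha hc (f ≫ g) = F.map ha hb f ≫ F.map hb hc g := by
  obtain ⟨y, l₁, k₁, hl₁, hk₁, rfl, -⟩ := r.exists_fac f
  obtain ⟨z, l₂, k₂, hl₂, hk₂, rfl, -⟩ := r.exists_fac g
  obtain ⟨x, l₃, k₃, hl₃, hk₃, e, -⟩ := r.exists_fac (k₁ ≫ l₂)
  have hy := F.mem_of_prop ha l₁ hl₁
  have hz := F.mem_of_prop hb l₂ hl₂
  have hx := F.mem_of_prop hy l₃ hl₃
  have e' : (l₁ ≫ k₁) ≫ l₂ ≫ k₂ = (l₁ ≫ l₃) ≫ k₃ ≫ k₂ := by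
    simp only [Category.assoc, reassoc_of% e]
  rw [e', F.map_eq ha hx hc _ (L.comp_mem _ _ hl₁ hl₃) _ (R.comp_mem _ _ hk₃ hk₂),
    F.map_eq ha hy hb _ hl₁ _ hk₁, F.map_eq hb hz hc _ hl₂ _ hk₂, ← mapL_comp hF ha hy hx,
    ← mapR_comp hF hx hz hc, Category.assoc, Category.assoc,
    ← Category.assoc (F.mapR hy hb k₁ hk₁), mapR_mapL hF, ← e, F.map_eq hy hx hz _ hl₃ _ hk₃,
    Category.assoc]

end CellFamily

end HomotopicalAlgebra.ReedyStructure

namespace HomotopicalAlgebra.ReedyStructure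

variable {K : Type w} [Category.{w} K] {L R : MorphismProperty K}
  [L.IsMultiplicative] [R.IsMultiplicative]
  {D : Type t} [LinearOrder D] [OrderBot D] [SuccOrder D] [WellFoundedLT D]
  {r : ReedyStructure L R D} {M : Type u} [Category.{v} M] {X Y : K ⥤ M}
  {φ : X ⟶ Y} {W₁ W₂ : MorphismProperty M}

namespace CellFamily

variable {F : r.CellFamily X Y} (hF : F.IsGood φ W₁ W₂)

include hF

lemma ix_mapR {b c : K} (hb : F.S b) (hc : F.S c) (f : b ⟶ c) (hf : R f) :
    (F.cell b hb).ix ≫ F.mapR hb hc f hf = X.map f ≫ (F.cell c hc).ix := by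
  by_cases hf' : MorphismProperty.identities K f
  · cases hf'
    rw [mapR_id, Category.comp_id, X.map_id, Category.id_comp]
  · exact (congrArg ((F.cell b hb).ix ≫ ·)
      (F.mapR_latchingHom (latchingMk f hf hf') hb hc)).trans ((hF c hc).ix_inn (latchingMk f hf hf'))

lemma ix_mapL {b c : K} (hb : F.S b) (hc : F.S c) (f : b ⟶ c) (hf : L f) :
    (F.cell b hb).ix ≫ F.mapL hb hc f hf = X.map f ≫ (F.cell c hc).ix := by
  by_cases hf' : MorphismProperty.identities K f
  · cases hf'
    rw [mapL_id, Category.comp_id, X.map_id, Category.id_comp]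
  · exact (congrArg ((F.cell b hb).ix ≫ ·)
      (F.mapL_matchingHom (matchingMk f hf hf') hb hc)).trans ((hF b hb).ix_out (matchingMk f hf hf'))

lemma mapR_py {b c : K} (hb : F.S b) (hc : F.S c) (f : b ⟶ c) (hf : R f) :
    F.mapR hb hc f hf ≫ (F.cell c hc).py = (F.cell b hb).py ≫ Y.map f := by
  by_cases hf' : MorphismProperty.identities K f
  · cases hf'
    rw [mapR_id, Category.id_comp, Y.map_id, Category.comp_id]
  · exact (congrArg (· ≫ (F.cell c hc).py)
      (F.mapR_latchingHom (latchingMk f hf hf') hb hc)).trans ((hF c hc).inn_py (latchingMk f hf hf'))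

lemma mapL_py {b c : K} (hb : F.S b) (hc : F.S c) (f : b ⟶ c) (hf : L f) :
    F.mapL hb hc f hf ≫ (F.cell c hc).py = (F.cell b hb).py ≫ Y.map f := by
  by_cases hf' : MorphismProperty.identities K f
  · cases hf'
    rw [mapL_id, Category.id_comp, Y.map_id, Category.comp_id]
  · exact (congrArg (· ≫ (F.cell c hc).py)
      (F.mapL_matchingHom (matchingMk f hf hf') hb hc)).trans ((hF b hb).out_py (matchingMk f hf hf'))

lemma ix_map {b c : K} (hb : F.S b) (hc : F.S c) (f : b ⟶ c) :
    (F.cell b hb).ix ≫ F.map hb hc f = X.map f ≫ (F.cell c hc).ix := by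
  rw [map, ← Category.assoc, ix_mapL hF, Category.assoc, ix_mapR hF, ← Category.assoc,
    ← X.map_comp, MorphismProperty.MapFactorizationData.fac]

lemma map_py {b c : K} (hb : F.S b) (hc : F.S c) (f : b ⟶ c) :
    F.map hb hc f ≫ (F.cell c hc).py = (F.cell b hb).py ≫ Y.map f := by
  rw [map, Category.assoc, mapR_py hF, ← Category.assoc, mapL_py hF, Category.assoc,
    ← Y.map_comp, MorphismProperty.MapFactorizationData.fac]

lemma map_mapL {a b c : K} (ha : F.S a) (hb : F.S b) (hc : F.S c) (f : a ⟶ b) (g : b ⟶ c)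
    (hg : L g) : F.map ha hb f ≫ F.mapL hb hc g hg = F.map ha hc (f ≫ g) := by
  rw [map_comp hF ha hb hc, F.map_eq_mapL hb hc g hg]

lemma mapR_map {a b c : K} (ha : F.S a) (hb : F.S b) (hc : F.S c) (f : a ⟶ b) (hf : R f)
    (g : b ⟶ c) : F.mapR ha hb f hf ≫ F.map hb hc g = F.map ha hc (f ≫ g) := by
  rw [map_comp hF ha hb hc, F.map_eq_mapR ha hb f hf]

/-- A family of good cells extends to an object all of whose predecessors belong to the family. -/
theorem exists_isGood [HasLimitsOfSize.{w, w} M] [HasColimitsOfSize.{w, w} M] [HasPushouts M]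
    [HasPullbacks M] [MorphismProperty.IsWeakFactorizationSystem W₁ W₂]
    (c : K) (hc : ∀ b, r.deg b < r.deg c → F.S b) :
    ∃ (Z : M) (e : r.Cell X Y c (fun b hb ↦ F.obj b (hc b hb)) Z), e.IsGood φ W₁ W₂ F hc := by
  have hl (k : LatchingCategory R c) : F.S k.left := hc _ (r.latching_deg_lt k)
  have hm (k : MatchingCategory L c) : F.S k.right := hc _ (r.matching_deg_lt k)
  -- The colimit of `FL` and the limit of `FM` will be the latching and matching objects at `c` of
  -- the diagram under construction; both depend only on lower degrees.
  let FL : LatchingCategory R c ⥤ M :=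
    { obj k := F.obj k.left (hl k)
      map {k k'} m := F.mapR (hl k) (hl k') m.left m.prop_hom_left
      map_id k := F.mapR_id (hl k) (R.id_mem _)
      map_comp {k k' k''} m m' := (mapR_comp hF (hl k) (hl k') (hl k'') _ _ _ _).symm }
  let FM : MatchingCategory L c ⥤ M :=
    { obj k := F.obj k.right (hm k)
      map {k k'} m := F.mapL (hm k) (hm k') m.right m.prop_hom_right
      map_id k := F.mapL_id (hm k) (L.id_mem _)
      map_comp {k k' k''} m m' := (mapL_comp hF (hm k) (hm k') (hm k'') _ _ _ _).symm }
  let α : latchingForget R c ⋙ X ⟶ FL :=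
    { app k := (F.cell k.left (hl k)).ix
      naturality k k' m := (ix_mapR hF (hl k) (hl k') m.left m.prop_hom_left).symm }
  let β : FM ⟶ matchingForget L c ⋙ Y :=
    { app k := (F.cell k.right (hm k)).py
      naturality k k' m := mapL_py hF (hm k) (hm k') m.right m.prop_hom_right }
  -- Here `U` plays the role of `X_c ⊔_{L_c X} L_c Z`, and `V` below that of `M_c Z ×_{M_c Y} Y_c`.
  obtain ⟨U, iX, iF, iF_w, iF_X, U_desc, U_ext⟩ :=
    exists_relative_colimit α (latchingCocone R X c)
  obtain ⟨V, pY, pF, pF_w, pF_Y, V_lift, V_ext⟩ :=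
    exists_relative_limit β (matchingCone L Y c)
  obtain ⟨aX, aX_Y, aX_F⟩ := V_lift (φ.app c)
    (fun m ↦ X.map (matchingHom m) ≫ (F.cell m.right (hm m)).ix)
    (fun m m' n ↦ by
      change (_ ≫ _) ≫ F.mapL (hm m) (hm m') n.right n.prop_hom_right = _
      rw [Category.assoc, ix_mapL hF, ← Category.assoc, ← X.map_comp, matchingHom_w])
    (fun m ↦ by
      change (_ ≫ (F.cell m.right (hm m)).ix) ≫ (F.cell m.right (hm m)).py =
        φ.app c ≫ Y.map (matchingHom m)
      rw [Category.assoc, (hF _ (hm m)).fac, NatTrans.naturality])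
  have aF (k : LatchingCategory R c) := V_lift
    ((F.cell k.left (hl k)).py ≫ Y.map (latchingHom k))
    (fun m ↦ F.map (hl k) (hm m) (latchingHom k ≫ matchingHom m))
    (fun m m' n ↦ by
      change _ ≫ F.mapL (hm m) (hm m') n.right n.prop_hom_right = _
      rw [map_mapL hF, Category.assoc, matchingHom_w])
    (fun m ↦ by
      change F.map (hl k) (hm m) (latchingHom k ≫ matchingHom m) ≫ (F.cell m.right (hm m)).py =
        _ ≫ Y.map (matchingHom m)
      rw [map_py hF, Y.map_comp, Category.assoc])
  choose aF aF_Y aF_F using aF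
  -- The canonical map `U ⟶ V` has as its latching-to-matching entries the values of the lower
  -- diagram on the composites through `c`. Factoring it through an object amounts to extending the
  -- diagram, together with the factorization of `φ`, to `c`.
  obtain ⟨d, hd, hd'⟩ := U_desc aX aF
    (fun k k' n ↦ by
      change F.mapR (hl k) (hl k') n.left n.prop_hom_left ≫ _ = _
      refine V_ext _ _ ?_ fun m ↦ ?_
      · rw [Category.assoc, aF_Y, aF_Y, ← Category.assoc, mapR_py hF, Category.assoc, ← Y.map_comp,
          latchingHom_w]
      · rw [Category.assoc, aF_F, aF_F, mapR_map hF, ← Category.assoc, latchingHom_w])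
    (fun k ↦ by
      change (F.cell k.left (hl k)).ix ≫ _ = X.map (latchingHom k) ≫ _
      refine V_ext _ _ ?_ fun m ↦ ?_
      · rw [Category.assoc, Category.assoc, aF_Y, aX_Y, ← Category.assoc, (hF _ (hl k)).fac,
          NatTrans.naturality]
      · rw [Category.assoc, Category.assoc, aF_F, aX_F, ix_map hF, X.map_comp, Category.assoc])
  let fd := MorphismProperty.factorizationData W₁ W₂ d
  refine ⟨fd.Z,
    { inn k := iF k ≫ fd.i
      out m := fd.p ≫ pF m
      ix := iX ≫ fd.i
      py := fd.p ≫ pY }, ?_⟩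
  constructor
  case inn_w =>
    intro k k' n
    exact (Category.assoc _ _ _).symm.trans (congrArg (· ≫ fd.i) (iF_w n))
  case out_w =>
    intro k k' n
    exact (Category.assoc _ _ _).trans (congrArg (fd.p ≫ ·) (pF_w n))
  case inn_out =>
    intro k m
    change (iF k ≫ fd.i) ≫ fd.p ≫ pF m = _
    rw [Category.assoc, fd.fac_assoc, ← Category.assoc, hd', aF_F]
  case fac =>
    change (iX ≫ fd.i) ≫ fd.p ≫ pY = _
    rw [Category.assoc, fd.fac_assoc, ← Category.assoc, hd, aX_Y]
  case ix_inn =>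
    intro k
    exact (Category.assoc _ _ _).symm.trans
      ((congrArg (· ≫ fd.i) (iF_X k)).trans (Category.assoc _ _ _))
  case ix_out =>
    intro m
    change (iX ≫ fd.i) ≫ fd.p ≫ pF m = _
    rw [Category.assoc, fd.fac_assoc, ← Category.assoc, hd, aX_F]
  case inn_py =>
    intro k
    change (iF k ≫ fd.i) ≫ fd.p ≫ pY = _
    rw [Category.assoc, fd.fac_assoc, ← Category.assoc, hd', aF_Y]
  case out_py =>
    intro m
    exact (Category.assoc _ _ _).trans
      ((congrArg (fd.p ≫ ·) (pF_Y m)).trans (Category.assoc _ _ _).symm)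
  case latching =>
    intro E B q hq s t v ht hs hv htv
    obtain ⟨a, ha, ha'⟩ := U_desc s t ht hs
    have sq : CommSq a fd.i q v := ⟨U_ext _ _ (by
      rw [← Category.assoc, ha, hv, Category.assoc]) (fun k ↦ by
      rw [← Category.assoc, ha', htv, Category.assoc])⟩
    have := MorphismProperty.hasLiftingProperty_of_wfs _ _ fd.hi hq
    refine ⟨sq.lift, ?_, fun k ↦ ?_, sq.fac_right⟩
    · rw [Category.assoc, sq.fac_left, ha]
    · exact (Category.assoc _ _ _).trans ((congrArg (iF k ≫ ·) sq.fac_left).trans (ha' k))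
  case matching =>
    intro U' V' j hj s t u ht hs hu htu
    obtain ⟨a, ha, ha'⟩ := V_lift s t ht hs
    have sq : CommSq u j fd.p a := ⟨V_ext _ _ (by
      rw [Category.assoc, Category.assoc, ha, hu]) (fun m ↦ by
      rw [Category.assoc, Category.assoc, ha', htu])⟩
    have := MorphismProperty.hasLiftingProperty_of_wfs _ _ hj fd.hp
    refine ⟨sq.lift, ?_, fun m ↦ ?_, sq.fac_left⟩
    · rw [← Category.assoc, sq.fac_right, ha]
    · exact (Category.assoc _ _ _).symm.trans ((congrArg (· ≫ pF m) sq.fac_right).trans (ha' m))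

end CellFamily

/-- The family in degrees less than that of `c`. -/
def CellFamily.below (c : K) (g : ∀ b, r.deg b < r.deg c → M)
    (p : ∀ b (h : r.deg b < r.deg c), r.Cell X Y b (fun a ha ↦ g a (ha.trans h)) (g b h)) :
    r.CellFamily X Y where
  S b := r.deg b < r.deg c
  closed _ hb _ ha := ha.trans hb
  obj := g
  cell := p

variable (r φ W₁ W₂) in
/-- There is a family of good cells on all objects. -/
theorem exists_cellFamily [HasLimitsOfSize.{w, w} M] [HasColimitsOfSize.{w, w} M] [HasPushouts M]
    [HasPullbacks M] [MorphismProperty.IsWeakFactorizationSystem W₁ W₂] :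
    ∃ F : r.CellFamily X Y, (∀ b, F.S b) ∧ F.IsGood φ W₁ W₂ := by
  -- The choices are the objects `Z_c`, the dependent data are the cells, and the conditions are
  -- goodness; this is why the choice principle has three layers.
  obtain ⟨g, p, H⟩ := exists_dependent_choice r.deg (fun _ ↦ M) (fun c g Z ↦ r.Cell X Y c g Z)
    (fun c g p Z e ↦ e.IsGood φ W₁ W₂ (CellFamily.below c g p) (fun _ hb ↦ hb))
    (fun c g p H ↦ by
      refine CellFamily.exists_isGood (F := CellFamily.below c g p) (φ := φ) (fun b hb ↦ ?_) c
        (fun _ hb ↦ hb)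
      have h := H b hb
      -- Goodness at `b` only involves the family in degrees less than that of `b`, where the
      -- truncations at `b` and at `c` agree definitionally; the fields can be reused one by one.
      exact ⟨h.inn_w, h.out_w, h.inn_out, h.fac, h.ix_inn, h.ix_out, h.inn_py, h.out_py,
        h.latching, h.matching⟩)
  refine ⟨⟨fun _ ↦ True, fun _ _ _ _ ↦ trivial, fun b _ ↦ g b, fun b _ ↦ p b⟩, fun _ ↦ trivial,
    fun c _ ↦ ?_⟩
  have h := H c
  exact ⟨h.inn_w, h.out_w, h.inn_out, h.fac, h.ix_inn, h.ix_out, h.inn_py, h.out_py,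
    h.latching, h.matching⟩

variable (φ W₁ W₂) in
/-- The Reedy factorization of a morphism of diagrams, for a weak factorization system `(W₁, W₂)`. -/
theorem exists_factorization (r : ReedyStructure L R D) [HasLimitsOfSize.{w, w} M] [HasColimitsOfSize.{w, w} M]
    [HasPushouts M] [HasPullbacks M] [MorphismProperty.IsWeakFactorizationSystem W₁ W₂] :
    ∃ (Z : K ⥤ M) (i : X ⟶ Z) (p : Z ⟶ Y), i ≫ p = φ ∧
      (∀ c, W₁ (relativeLatchingMap R i c)) ∧ ∀ c, W₂ (relativeMatchingMap L p c) := by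
  obtain ⟨F, hS, hF⟩ := exists_cellFamily r φ W₁ W₂
  let Z : K ⥤ M :=
    { obj c := F.obj c (hS c)
      map f := F.map (hS _) (hS _) f
      map_id c := (F.map_eq_mapR _ _ _ (R.id_mem c)).trans (F.mapR_id _ _)
      map_comp f g := CellFamily.map_comp hF _ _ _ f g }
  have Z_mapR {b c : K} (f : b ⟶ c) (hf : R f) : Z.map f = F.mapR (hS b) (hS c) f hf :=
    F.map_eq_mapR _ _ f hf
  have Z_mapL {b c : K} (f : b ⟶ c) (hf : L f) : Z.map f = F.mapL (hS b) (hS c) f hf :=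
    F.map_eq_mapL _ _ f hf
  have Z_latching {c : K} (k : LatchingCategory R c) :
      Z.map (latchingHom k) = (F.cell c (hS c)).inn k :=
    (Z_mapR _ k.prop.1).trans (F.mapR_latchingHom k _ _)
  have Z_matching {c : K} (k : MatchingCategory L c) :
      Z.map (matchingHom k) = (F.cell c (hS c)).out k :=
    (Z_mapL _ k.prop.1).trans (F.mapL_matchingHom k _ _)
  let i : X ⟶ Z :=
    { app c := (F.cell c (hS c)).ix
      naturality _ _ f := (CellFamily.ix_map hF _ _ f).symm }
  let p : Z ⟶ Y :=
    { app c := (F.cell c (hS c)).py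
      naturality _ _ f := CellFamily.map_py hF _ _ f }
  refine ⟨Z, i, p, ?_, fun c ↦ ?_, fun c ↦ ?_⟩
  · ext c
    exact (hF c (hS c)).fac
  -- The left class is the class of maps lifting against `W₂`, so the unpacked lifting property
  -- stored in the cells suffices.
  · rw [← MorphismProperty.llp_eq_of_wfs W₁ W₂]
    intro E B q hq
    refine (hasLiftingProperty_relativeLatchingMap_iff q).2 fun s t v ht hs hv htv ↦ ?_
    obtain ⟨h, h₁, h₂, h₃⟩ := (hF c (hS c)).latching q hq s t v
      (fun k k' m ↦ (congrArg (· ≫ t k') (Z_mapR m.left m.prop_hom_left)).symm.trans (ht k k' m))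
      hs hv (fun k ↦ (htv k).trans (congrArg (· ≫ v) (Z_latching k)))
    exact ⟨h, h₁, fun k ↦ (congrArg (· ≫ h) (Z_latching k)).trans (h₂ k), h₃⟩
  · rw [← MorphismProperty.rlp_eq_of_wfs W₁ W₂]
    intro U V j hj
    refine (hasLiftingProperty_relativeMatchingMap_iff j).2 fun s t u ht hs hu htu ↦ ?_
    obtain ⟨h, h₁, h₂, h₃⟩ := (hF c (hS c)).matching j hj s t u
      (fun k k' m ↦ (congrArg (t k ≫ ·) (Z_mapL m.right m.prop_hom_right)).symm.trans (ht k k' m))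
      hs hu (fun k ↦ (htu k).trans (congrArg (u ≫ ·) (Z_matching k)))
    exact ⟨h, h₁, fun k ↦ (congrArg (h ≫ ·) (Z_matching k)).trans (h₂ k), h₃⟩

end HomotopicalAlgebra.ReedyStructure

/-! ### The Reedy model structure -/

section Classes

variable {K : Type w} [Category.{w} K] {M : Type u} [Category.{v} M]

/-- The morphisms of diagrams whose relative latching maps belong to `W`. -/
def relativeLatchingClass [HasColimitsOfSize.{w, w} M] [HasPushouts M]
    (R : MorphismProperty K) [R.IsMultiplicative] (W : MorphismProperty M) :
    MorphismProperty (K ⥤ M) :=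
  fun _ _ φ ↦ ∀ c, W (relativeLatchingMap R φ c)

/-- The morphisms of diagrams whose relative matching maps belong to `W`. -/
def relativeMatchingClass [HasLimitsOfSize.{w, w} M] [HasPullbacks M]
    (L : MorphismProperty K) [L.IsMultiplicative] (W : MorphismProperty M) :
    MorphismProperty (K ⥤ M) :=
  fun _ _ φ ↦ ∀ c, W (relativeMatchingMap L φ c)

/-- A class of morphisms which is the left class of a weak factorization system contains the
relative latching maps of retracts of morphisms whose relative latching maps belong to it. -/
lemma isStableUnderRetracts_relativeLatchingClass [HasColimitsOfSize.{w, w} M] [HasPushouts M]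
    (R : MorphismProperty K) [R.IsMultiplicative] (W₁ W₂ : MorphismProperty M)
    [MorphismProperty.IsWeakFactorizationSystem W₁ W₂] :
    (relativeLatchingClass R W₁).IsStableUnderRetracts where
  of_retract {X Y Z W φ ψ} h hψ c := by
    rw [← MorphismProperty.llp_eq_of_wfs W₁ W₂]
    intro E B q hq
    refine (hasLiftingProperty_relativeLatchingMap_iff q).2 fun s t v ht hs hv htv ↦ ?_
    obtain ⟨iX, iY, rX, rY, hi, hr, hil, hir⟩ : ∃ (iX : X ⟶ Z) (iY : Y ⟶ W) (rX : Z ⟶ X)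
        (rY : W ⟶ Y), (∀ d, iX.app d ≫ ψ.app d = φ.app d ≫ iY.app d) ∧
        (∀ d, rX.app d ≫ φ.app d = ψ.app d ≫ rY.app d) ∧
        (∀ d, iX.app d ≫ rX.app d = 𝟙 _) ∧ ∀ d, iY.app d ≫ rY.app d = 𝟙 _ :=
      ⟨h.i.left, h.i.right, h.r.left, h.r.right, NatTrans.congr_app h.i.w,
        NatTrans.congr_app h.r.w,
        NatTrans.congr_app (congrArg (fun k ↦ k.left) h.retract),
        NatTrans.congr_app (congrArg (fun k ↦ k.right) h.retract)⟩
    -- The retraction turns the lifting problem for `φ` into one for `ψ`; restricting the solution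
    -- along the section solves the original. No retract diagram of relative latching maps is
    -- needed.
    obtain ⟨g, g₁, g₂, g₃⟩ := (hasLiftingProperty_relativeLatchingMap_iff (R := R) q).1
      (MorphismProperty.hasLiftingProperty_of_wfs _ _ (hψ c) hq)
      (rX.app c ≫ s) (fun b ↦ rY.app b.left ≫ t b) (rY.app c ≫ v)
      (fun b b' k ↦ by
        rw [← Category.assoc, rY.naturality, Category.assoc, ht])
      (fun b ↦ by
        rw [← Category.assoc, ← hr, Category.assoc, hs, ← Category.assoc,
          ← rX.naturality, Category.assoc])
      (by rw [Category.assoc, hv, ← Category.assoc, hr, Category.assoc])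
      (fun b ↦ by
        rw [Category.assoc, htv, ← Category.assoc, ← rY.naturality, Category.assoc])
    refine ⟨iY.app c ≫ g, ?_, fun b ↦ ?_, ?_⟩
    · rw [← Category.assoc, ← hi, Category.assoc, g₁, ← Category.assoc, hil, Category.id_comp]
    · rw [← Category.assoc, iY.naturality, Category.assoc, g₂, ← Category.assoc, hir,
        Category.id_comp]
    · rw [Category.assoc, g₃, ← Category.assoc, hir, Category.id_comp]

/-- A class of morphisms which is the right class of a weak factorization system contains the
relative matching maps of retracts of morphisms whose relative matching maps belong to it. -/
lemma isStableUnderRetracts_relativeMatchingClass [HasLimitsOfSize.{w, w} M] [HasPullbacks M]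
    (L : MorphismProperty K) [L.IsMultiplicative] (W₁ W₂ : MorphismProperty M)
    [MorphismProperty.IsWeakFactorizationSystem W₁ W₂] :
    (relativeMatchingClass L W₂).IsStableUnderRetracts where
  of_retract {X Y Z W φ ψ} h hψ c := by
    rw [← MorphismProperty.rlp_eq_of_wfs W₁ W₂]
    intro U V j hj
    refine (hasLiftingProperty_relativeMatchingMap_iff j).2 fun s t u ht hs hu htu ↦ ?_
    obtain ⟨iX, iY, rX, rY, hi, hr, hil, hir⟩ : ∃ (iX : X ⟶ Z) (iY : Y ⟶ W) (rX : Z ⟶ X)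
        (rY : W ⟶ Y), (∀ d, iX.app d ≫ ψ.app d = φ.app d ≫ iY.app d) ∧
        (∀ d, rX.app d ≫ φ.app d = ψ.app d ≫ rY.app d) ∧
        (∀ d, iX.app d ≫ rX.app d = 𝟙 _) ∧ ∀ d, iY.app d ≫ rY.app d = 𝟙 _ :=
      ⟨h.i.left, h.i.right, h.r.left, h.r.right, NatTrans.congr_app h.i.w,
        NatTrans.congr_app h.r.w,
        NatTrans.congr_app (congrArg (fun k ↦ k.left) h.retract),
        NatTrans.congr_app (congrArg (fun k ↦ k.right) h.retract)⟩
    obtain ⟨g, g₁, g₂, g₃⟩ := (hasLiftingProperty_relativeMatchingMap_iff (L := L) j).1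
      (MorphismProperty.hasLiftingProperty_of_wfs _ _ hj (hψ c))
      (s ≫ iY.app c) (fun b ↦ t b ≫ iX.app b.right) (u ≫ iX.app c)
      (fun b b' k ↦ by
        rw [Category.assoc, ← iX.naturality, ← Category.assoc, ht])
      (fun b ↦ by
        rw [Category.assoc, hi, ← Category.assoc, hs, Category.assoc, iY.naturality,
          Category.assoc])
      (by rw [← Category.assoc, hu, Category.assoc, ← hi, Category.assoc])
      (fun b ↦ by
        rw [← Category.assoc, htu, Category.assoc, iX.naturality, Category.assoc])
    refine ⟨g ≫ rX.app c, ?_, fun b ↦ ?_, ?_⟩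
    · rw [Category.assoc, hr, ← Category.assoc, g₁, Category.assoc, hir, Category.comp_id]
    · rw [Category.assoc, ← rX.naturality, ← Category.assoc, g₂, Category.assoc, hil,
        Category.comp_id]
    · rw [← Category.assoc, g₃, Category.assoc, hil, Category.comp_id]

end Classes

/-! ### Induced weak factorization systems and the model category axioms -/

namespace HomotopicalAlgebra.ReedyStructure

variable {K : Type w} [Category.{w} K] {L R : MorphismProperty K}
  [L.IsMultiplicative] [R.IsMultiplicative]
  {D : Type t} [LinearOrder D] [OrderBot D] [SuccOrder D] [WellFoundedLT D]
  (r : ReedyStructure L R D) {M : Type u} [Category.{v} M]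

/-- `W₁` is characterized by lifting against `W₂`, so the inheritance of lifting properties by maps
of latching objects gives membership. -/
lemma latchingMap_mem [HasColimitsOfSize.{w, w} M] [HasPushouts M]
    {X Y : K ⥤ M} {φ : X ⟶ Y} (W₁ W₂ : MorphismProperty M)
    [MorphismProperty.IsWeakFactorizationSystem W₁ W₂] (c : K) (h : ∀ b, r.deg b < r.deg c → W₁ (relativeLatchingMap R φ b)) :
    W₁ (latchingMap R φ c) := by
  rw [← MorphismProperty.llp_eq_of_wfs W₁ W₂]
  exact fun _ _ q hq ↦ r.hasLiftingProperty_latchingMap φ c q fun b hb ↦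
    MorphismProperty.hasLiftingProperty_of_wfs _ _ (h b hb) hq

lemma matchingMap_mem [HasLimitsOfSize.{w, w} M] [HasPullbacks M]
    {X Y : K ⥤ M} {φ : X ⟶ Y} (W₁ W₂ : MorphismProperty M)
    [MorphismProperty.IsWeakFactorizationSystem W₁ W₂] (c : K) (h : ∀ b, r.deg b < r.deg c → W₂ (relativeMatchingMap L φ b)) :
    W₂ (matchingMap L φ c) := by
  rw [← MorphismProperty.rlp_eq_of_wfs W₁ W₂]
  exact fun _ _ j hj ↦ r.hasLiftingProperty_matchingMap φ c j fun b hb ↦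
    MorphismProperty.hasLiftingProperty_of_wfs _ _ hj (h b hb)

variable [HasLimitsOfSize.{w, w} M] [HasColimitsOfSize.{w, w} M]

section

variable [HasPushouts M] [HasPullbacks M]
  {X Y : K ⥤ M} {φ : X ⟶ Y}

include r in
/-- A weak factorization system on `M` induces a weak factorization system on diagrams. -/
theorem isWeakFactorizationSystem (W₁ W₂ : MorphismProperty M)
    [MorphismProperty.IsWeakFactorizationSystem W₁ W₂] :
    MorphismProperty.IsWeakFactorizationSystem
      (relativeLatchingClass (K := K) R W₁) (relativeMatchingClass L W₂) := by
  have := isStableUnderRetracts_relativeLatchingClass (K := K) R W₁ W₂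
  have := isStableUnderRetracts_relativeMatchingClass (K := K) L W₁ W₂
  have : MorphismProperty.HasFactorization (relativeLatchingClass (K := K) R W₁)
      (relativeMatchingClass L W₂) := ⟨fun φ ↦ by
    obtain ⟨Z, i, p, fac, hi, hp⟩ := exists_factorization φ W₁ W₂ r
    exact ⟨⟨Z, i, p, fac, hi, hp⟩⟩⟩
  -- Factorization, lifting and closure under retracts suffice: the retract argument then identifies
  -- each class with the one determined by the lifting property.
  exact .mk' _ _ fun i p hi hp ↦ r.hasLiftingProperty_of_relative i p fun c ↦
    MorphismProperty.hasLiftingProperty_of_wfs _ _ (hi c) (hp c)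

/-- The map is a cobase change of the map of latching objects, and a class defined by left lifting
is stable under cobase change. -/
lemma pushout_inl_mem (W₁ W₂ : MorphismProperty M)
    [MorphismProperty.IsWeakFactorizationSystem W₁ W₂] (c : K) (h : ∀ b, r.deg b < r.deg c → W₁ (relativeLatchingMap R φ b)) :
    W₁ (pushout.inl (latchingι R X c) (latchingMap R φ c)) := by
  have : W₁.IsStableUnderCobaseChange := by
    rw [← MorphismProperty.llp_eq_of_wfs W₁ W₂]
    infer_instance
  exact W₁.pushout_inl _ _ (r.latchingMap_mem W₁ W₂ c h)

lemma pullback_snd_mem (W₁ W₂ : MorphismProperty M)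
    [MorphismProperty.IsWeakFactorizationSystem W₁ W₂] (c : K) (h : ∀ b, r.deg b < r.deg c → W₂ (relativeMatchingMap L φ b)) :
    W₂ (pullback.snd (matchingMap L φ c) (matchingπ L Y c)) := by
  have : W₂.IsStableUnderBaseChange := by
    rw [← MorphismProperty.rlp_eq_of_wfs W₁ W₂]
    infer_instance
  exact W₂.pullback_snd _ _ (r.matchingMap_mem W₁ W₂ c h)

include r in
-- The component `φ_c` is a cobase change of the map of latching objects followed by the relative
-- latching map; both factors lie in `W₁`.
lemma app_mem_of_relativeLatchingClass (W₁ W₂ : MorphismProperty M)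
    [MorphismProperty.IsWeakFactorizationSystem W₁ W₂] (h : relativeLatchingClass R W₁ φ) (c : K) :
    W₁ (φ.app c) := by
  have : W₁.IsMultiplicative := by
    rw [← MorphismProperty.llp_eq_of_wfs W₁ W₂]
    infer_instance
  rw [← inl_relativeLatchingMap (R := R)]
  exact W₁.comp_mem _ _ (r.pushout_inl_mem W₁ W₂ c fun b _ ↦ h b) (h c)

include r in
lemma app_mem_of_relativeMatchingClass (W₁ W₂ : MorphismProperty M)
    [MorphismProperty.IsWeakFactorizationSystem W₁ W₂] (h : relativeMatchingClass L W₂ φ) (c : K) :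
    W₂ (φ.app c) := by
  have : W₂.IsMultiplicative := by
    rw [← MorphismProperty.rlp_eq_of_wfs W₁ W₂]
    infer_instance
  rw [← relativeMatchingMap_snd (L := L)]
  exact W₂.comp_mem _ _ (h c) (r.pullback_snd_mem W₁ W₂ c fun b _ ↦ h b)

end

section

variable [ModelCategory M] {X Y : K ⥤ M} (φ : X ⟶ Y)

include r in
-- This makes the two induced factorization systems fit together. The forward direction uses that
-- components inherit membership. For the converse, by induction on degree, the map `X_c ⟶ X_c
-- ⊔_{L_c X} L_c Y` is a trivial cofibration, and two out of three applies to its composite `φ_c`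
-- with the relative latching map.
lemma relativeLatchingClass_trivialCofibrations_iff :
    relativeLatchingClass R (trivialCofibrations M) φ ↔
      relativeLatchingClass R (cofibrations M) φ ∧ ∀ c, weakEquivalences M (φ.app c) := by
  refine ⟨fun h ↦ ⟨fun c ↦ (h c).1, fun c ↦
    (r.app_mem_of_relativeLatchingClass (trivialCofibrations M) (fibrations M) h c).2⟩, ?_⟩
  rintro ⟨h, h'⟩ c
  induction hd : r.deg c using WellFoundedLT.induction generalizing c with
  | _ d hrec =>
    subst hd
    exact ⟨h c, (weakEquivalences M).of_precomp _ _
      (r.pushout_inl_mem (trivialCofibrations M) (fibrations M) c fun b hb ↦ hrec _ hb b rfl).2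
      (by simpa using h' c)⟩

include r in
lemma relativeMatchingClass_trivialFibrations_iff :
    relativeMatchingClass L (trivialFibrations M) φ ↔
      relativeMatchingClass L (fibrations M) φ ∧ ∀ c, weakEquivalences M (φ.app c) := by
  refine ⟨fun h ↦ ⟨fun c ↦ (h c).1, fun c ↦
    (r.app_mem_of_relativeMatchingClass (cofibrations M) (trivialFibrations M) h c).2⟩, ?_⟩
  rintro ⟨h, h'⟩ c
  induction hd : r.deg c using WellFoundedLT.induction generalizing c with
  | _ d hrec =>
    subst hd
    exact ⟨h c, (weakEquivalences M).of_postcomp _ _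
      (r.pullback_snd_mem (cofibrations M) (trivialFibrations M) c fun b hb ↦ hrec _ hb b rfl).2
      (by simpa using h' c)⟩

end

variable (M) in
/-- The Reedy model structure. -/
@[reducible]
def modelCategory [ModelCategory M] : ModelCategory (K ⥤ M) :=
  letI : CategoryWithWeakEquivalences (K ⥤ M) :=
    ⟨fun _ _ φ ↦ ∀ c, weakEquivalences M (φ.app c)⟩
  letI : CategoryWithCofibrations (K ⥤ M) := ⟨relativeLatchingClass R (cofibrations M)⟩
  letI : CategoryWithFibrations (K ⥤ M) := ⟨relativeMatchingClass L (fibrations M)⟩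
  have : (weakEquivalences (K ⥤ M)).HasTwoOutOfThreeProperty :=
    { comp_mem _ _ h h' c := (weakEquivalences M).comp_mem _ _ (h c) (h' c)
      of_postcomp _ _ h h' c := (weakEquivalences M).of_postcomp _ _ (h c) (h' c)
      of_precomp _ _ h h' c := (weakEquivalences M).of_precomp _ _ (h c) (h' c) }
  -- After this identification and its dual, each required factorization system is induced by one of
  -- the two systems of `M`.
  have hc : trivialCofibrations (K ⥤ M) = relativeLatchingClass R (trivialCofibrations M) := by
    ext X Y φ
    exact (r.relativeLatchingClass_trivialCofibrations_iff φ).symm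
  have hf : trivialFibrations (K ⥤ M) = relativeMatchingClass L (trivialFibrations M) := by
    ext X Y φ
    exact (r.relativeMatchingClass_trivialFibrations_iff φ).symm
  have : MorphismProperty.IsWeakFactorizationSystem (trivialCofibrations (K ⥤ M))
      (fibrations (K ⥤ M)) := by
    rw [hc]
    exact r.isWeakFactorizationSystem _ _
  have : MorphismProperty.IsWeakFactorizationSystem (cofibrations (K ⥤ M))
      (trivialFibrations (K ⥤ M)) := by
    rw [hf]
    exact r.isWeakFactorizationSystem _ _
  ModelCategory.mk' _

theorem isReedyModelStructure_modelCategory [ModelCategory M] :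
    IsReedyModelStructure L R (r.modelCategory M) where
  weakEquivalence_iff _ := forall_congr' fun _ ↦ (weakEquivalence_iff _).symm
  cofibration_iff _ := forall_congr' fun _ ↦ (cofibration_iff _).symm
  fibration_iff _ := forall_congr' fun _ ↦ (fibration_iff _).symm

/-- Evaluation preserves the initial object, and the components of a Reedy cofibration are
cofibrations. -/
lemma isCofibrant_obj [ModelCategory M] (X : K ⥤ M)
    (hX : letI := r.modelCategory M; IsCofibrant X) (c : K) : IsCofibrant (X.obj c) := by
  let := r.modelCategory M
  have h : relativeLatchingClass R (cofibrations M) (initial.to X) := (cofibration_iff _).1 hX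
  have h' := r.app_mem_of_relativeLatchingClass (cofibrations M) (trivialFibrations M) h c
  have hI : IsInitial ((⊥_ (K ⥤ M)).obj c) :=
    IsInitial.isInitialObj ((evaluation K M).obj c) _ initialIsInitial
  exact (isCofibrant_iff_of_isInitial _ hI).2 ((cofibration_iff _).2 h')

end HomotopicalAlgebra.ReedyStructure

/-! ### The pushout-product axiom and the unit axiom for diagrams -/

section PushoutProduct

variable {K : Type w} [Category.{w} K] {M : Type u} [Category.{v} M]
  [HasColimitsOfSize.{w, w} M] [HasPushouts M] [HasPullbacks M]
  [MonoidalCategory M] [MonoidalClosed M]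
  {R : MorphismProperty K} [R.IsMultiplicative] {Z Z' : M} {f : Z ⟶ Z'} {X Y : K ⥤ M} {i : X ⟶ Y}

open MonoidalClosed in
-- Currying turns a lifting problem of the relative latching map of the pushout-product against `q`
-- into one of the relative latching map of `i` against the pullback-hom `[Z', E] ⟶ [Z, E] ×_{[Z,
-- B]} [Z', B]`. The latter is solvable by the two-variable adjunction. Thus latching objects never
-- have to be commuted with tensors and pushouts.
lemma hasLiftingProperty_relativeLatchingMap_of_isPushout {P : K ⥤ M}
    (inl : X ⋙ tensorLeft Z' ⟶ P) (inr : Y ⋙ tensorLeft Z ⟶ P) (ι : P ⟶ Y ⋙ tensorLeft Z')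
    (inl_ι : ∀ c, inl.app c ≫ ι.app c = Z' ◁ i.app c)
    (inr_ι : ∀ c, inr.app c ≫ ι.app c = f ▷ Y.obj c)
    (sq : ∀ c, IsPushout (f ▷ X.obj c) (Z ◁ i.app c) (inl.app c) (inr.app c)) (c : K)
    {E B : M} (q : E ⟶ B)
    (hq : HasLiftingProperty ((curriedTensor M).leibnizPushout.obj (Arrow.mk f) |>.obj
      (Arrow.mk (relativeLatchingMap R i c))).hom q) :
    HasLiftingProperty (relativeLatchingMap R ι c) q := by
  let sq₁₃ := Functor.PullbackObjObj.ofHasPullback (internalHom (C := M)) f q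
  have h₁₃ : HasLiftingProperty (relativeLatchingMap R i c) sq₁₃.π :=
    (internalHomAdjunction₂.hasLiftingProperty_iff
      (Functor.PushoutObjObj.ofHasPushout _ f (relativeLatchingMap R i c)) sq₁₃).1 hq
  obtain ⟨Q, fst, snd, π, hQ, π_fst, π_snd, hπ⟩ : ∃ (Q : M) (fst : Q ⟶ (ihom Z).obj E)
      (snd : Q ⟶ (ihom Z').obj B) (π : (ihom Z').obj E ⟶ Q)
      (_ : IsPullback fst snd ((ihom Z).map q) ((pre f).app B)),
      π ≫ fst = (pre f).app E ∧ π ≫ snd = (ihom Z').map q ∧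
        HasLiftingProperty (relativeLatchingMap R i c) π :=
    ⟨_, _, _, _, sq₁₃.isPullback, sq₁₃.π_fst, sq₁₃.π_snd, h₁₃⟩
  have inl_nat {a b : K} (g : a ⟶ b) : Z' ◁ X.map g ≫ inl.app b = inl.app a ≫ P.map g :=
    inl.naturality g
  have inr_nat {a b : K} (g : a ⟶ b) : Z ◁ Y.map g ≫ inr.app b = inr.app a ≫ P.map g :=
    inr.naturality g
  refine (hasLiftingProperty_relativeLatchingMap_iff q).2 fun s t v ht hs hv htv ↦ ?_
  replace ht (b b' : LatchingCategory R c) (k : b ⟶ b') : Z' ◁ Y.map k.left ≫ t b' = t b :=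
    ht b b' k
  replace htv (b : LatchingCategory R c) : t b ≫ q = Z' ◁ Y.map (latchingHom b) ≫ v := htv b
  -- The base of the transposed problem combines the restriction of `s` to `Z ⊗ Y_c` with `v`; the
  -- restriction of `s` to `Z' ⊗ X_c` and the maps `t` give its top.
  let v' : Y.obj c ⟶ Q := hQ.lift (curry (inr.app c ≫ s)) (curry v) (by
    rw [← curry_natural_right, curry_pre_app, Category.assoc, hv, ← Category.assoc, inr_ι])
  have v'_fst : v' ≫ fst = curry (inr.app c ≫ s) := hQ.lift_fst _ _ _
  have v'_snd : v' ≫ snd = curry v := hQ.lift_snd _ _ _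
  obtain ⟨h, h₁, h₂, h₃⟩ := (hasLiftingProperty_relativeLatchingMap_iff π).1 hπ
    (curry (inl.app c ≫ s)) (fun b ↦ curry (t b)) v'
    (fun b b' k ↦ by rw [← curry_natural_left, ht])
    (fun b ↦ by
      rw [← curry_natural_left, ← curry_natural_left, ← Category.assoc, inl_nat, Category.assoc,
        ← hs, ← Category.assoc, inl_ι])
    (hQ.hom_ext
      (by
        rw [Category.assoc, Category.assoc, π_fst, v'_fst, curry_pre_app, ← curry_natural_left,
          (sq c).w_assoc])
      (by
        rw [Category.assoc, Category.assoc, π_snd, v'_snd, ← curry_natural_right,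
          ← curry_natural_left, Category.assoc, hv, ← Category.assoc, inl_ι]))
    (fun b ↦ hQ.hom_ext
      (by
        rw [Category.assoc, Category.assoc, π_fst, v'_fst, curry_pre_app, ← curry_natural_left,
          ← Category.assoc, inr_nat, Category.assoc, ← hs, ← Category.assoc, inr_ι])
      (by
        rw [Category.assoc, Category.assoc, π_snd, v'_snd, ← curry_natural_right,
          ← curry_natural_left, htv]))
  refine ⟨uncurry h, (sq c).hom_ext ?_ ?_, fun b ↦ ?_, ?_⟩
  · rw [← Category.assoc, inl_ι, ← uncurry_natural_left, h₁, uncurry_curry]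
  · have h₄ : h ≫ (pre f).app E = curry (inr.app c ≫ s) := by
      rw [← π_fst, ← Category.assoc, h₃, v'_fst]
    rw [← Category.assoc, inr_ι, ← uncurry_pre_app, h₄, uncurry_curry]
  · refine (uncurry_natural_left (Y.map (latchingHom b)) h).symm.trans ?_
    rw [h₂, uncurry_curry]
  · rw [← uncurry_natural_right, ← π_snd, ← Category.assoc, h₃, v'_snd, uncurry_curry]

/-- If the pushout-product of `f` with the relative latching map of `i` at `c` has the left lifting
property with respect to `q`, then so has the relative latching map at `c` of the
pushout-product of `f` with `i`. -/
lemma hasLiftingProperty_relativeLatchingMap_pushoutProduct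
    (sq : (diagramTensor K M).PushoutObjObj f i) (c : K) {E B : M} (q : E ⟶ B)
    (hq : HasLiftingProperty ((curriedTensor M).leibnizPushout.obj (Arrow.mk f) |>.obj
      (Arrow.mk (relativeLatchingMap R i c))).hom q) :
    HasLiftingProperty (relativeLatchingMap R sq.ι c) q :=
  hasLiftingProperty_relativeLatchingMap_of_isPushout (i := i) (f := f) (P := sq.pt)
    sq.inl sq.inr sq.ι
    (fun c ↦ NatTrans.congr_app sq.inl_ι c) (fun c ↦ NatTrans.congr_app sq.inr_ι c)
    (fun c ↦ sq.isPushout.map ((evaluation K M).obj c)) c q hq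

end PushoutProduct

namespace HomotopicalAlgebra.ReedyStructure

variable {K : Type w} [Category.{w} K] {L R : MorphismProperty K}
  [L.IsMultiplicative] [R.IsMultiplicative]
  {D : Type t} [LinearOrder D] [OrderBot D] [SuccOrder D] [WellFoundedLT D]
  (r : ReedyStructure L R D) {M : Type u} [Category.{v} M]
  [HasColimitsOfSize.{w, w} M] [MonoidalCategory M] [MonoidalClosed M] [ModelCategory M]

lemma relativeLatchingClass_pushoutProduct (W₁ W₂ : MorphismProperty M)
    [MorphismProperty.IsWeakFactorizationSystem W₁ W₂] {Z Z' : M} {f : Z ⟶ Z'} {X Y : K ⥤ M}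
    {i : X ⟶ Y} (sq : (diagramTensor K M).PushoutObjObj f i)
    (h : ∀ c, W₁ ((curriedTensor M).leibnizPushout.obj (Arrow.mk f) |>.obj
      (Arrow.mk (relativeLatchingMap R i c))).hom) :
    relativeLatchingClass R W₁ sq.ι := fun c ↦ by
  rw [← MorphismProperty.llp_eq_of_wfs W₁ W₂]
  exact fun _ _ q hq ↦ hasLiftingProperty_relativeLatchingMap_pushoutProduct sq c q
    (MorphismProperty.hasLiftingProperty_of_wfs _ _ (h c) hq)

variable [HasLimitsOfSize.{w, w} M]

/-- At each `c` the axiom of `M` is applied to `f` and the relative latching map of `i`. If `i` is a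
weak equivalence, that map is a trivial cofibration by
`relativeLatchingClass_trivialCofibrations_iff`, and the same equivalence converts the conclusion
back into objectwise weak equivalences. -/
theorem pushoutProductAxiom (h : PushoutProductAxiom (curriedTensor M)) :
    letI := r.modelCategory M
    PushoutProductAxiom (diagramTensor K M) := by
  let := r.modelCategory M
  constructor
  · intro Z Z' f X Y i sq hf hi
    have hi' : ∀ c, Cofibration (relativeLatchingMap R i c) :=
      (r.isReedyModelStructure_modelCategory.cofibration_iff i).1 ((cofibration_iff i).1 hi)
    refine (cofibration_iff _).2 (relativeLatchingClass_pushoutProduct (R := R) (cofibrations M)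
      (trivialFibrations M) sq fun c ↦ ?_)
    exact (cofibration_iff _).1 (h.cofibration f (relativeLatchingMap R i c)
      (Functor.PushoutObjObj.ofHasPushout _ _ _) hf (hi' c))
  · intro Z Z' f X Y i sq hf hi hw
    have hi' : ∀ c, Cofibration (relativeLatchingMap R i c) :=
      (r.isReedyModelStructure_modelCategory.cofibration_iff i).1 ((cofibration_iff i).1 hi)
    refine (weakEquivalence_iff _).2 ((r.relativeLatchingClass_trivialCofibrations_iff _).1
      (relativeLatchingClass_pushoutProduct (R := R) (trivialCofibrations M)
      (fibrations M) sq fun c ↦ ?_)).2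
    refine ⟨(cofibration_iff _).1 (h.cofibration f (relativeLatchingMap R i c)
      (Functor.PushoutObjObj.ofHasPushout _ _ _) hf (hi' c)),
      (weakEquivalence_iff _).1 (h.weakEquivalence f (relativeLatchingMap R i c)
      (Functor.PushoutObjObj.ofHasPushout _ _ _) hf (hi' c) (hw.imp_right fun hw ↦ ?_))⟩
    exact (weakEquivalence_iff _).2 ((r.relativeLatchingClass_trivialCofibrations_iff i).2
      ⟨fun c ↦ (cofibration_iff _).1 (hi' c), (weakEquivalence_iff i).1 hw⟩ c).2

theorem unitAxiom (h : UnitAxiom (curriedTensor M)) :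
    letI := r.modelCategory M
    UnitAxiom (diagramTensor K M) := by
  let := r.modelCategory M
  intro Q q hQ hq X hX
  exact (weakEquivalence_iff _).2 fun c ↦
    (weakEquivalence_iff _).1 (h q hQ hq (X.obj c) (r.isCofibrant_obj X hX c))

end HomotopicalAlgebra.ReedyStructure

/-! ### The enriched homs of a diagram category -/

section DiagramHom

open MonoidalClosed

variable {K : Type w} [Category.{w} K] {M : Type u} [Category.{v} M]
  [MonoidalCategory M] [MonoidalClosed M] [HasLimitsOfSize.{w, w} M] {X Y : K ⥤ M}

/-- The projection from `Hom(X, Y)` to `[X_c, Y_c]`. -/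
def diagramHomπ (X Y : K ⥤ M) (c : K) : (X ⟶[M] Y) ⟶ (ihom (X.obj c)).obj (Y.obj c) :=
  Enriched.FunctorCategory.enrichedHomπ M X Y c

lemma diagramHom_condition {b c : K} (f : b ⟶ c) :
    diagramHomπ X Y b ≫ (ihom (X.obj b)).map (Y.map f) =
      diagramHomπ X Y c ≫ (pre (X.map f)).app (Y.obj c) := by
  have h := Enriched.FunctorCategory.enrichedHom_condition M X Y f
  rwa [enrichedOrdinaryCategorySelf_eHomWhiskerLeft,
    enrichedOrdinaryCategorySelf_eHomWhiskerRight] at h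

lemma diagramHom_hom_ext {Z : M} {f g : Z ⟶ (X ⟶[M] Y)}
    (h : ∀ c, f ≫ diagramHomπ X Y c = g ≫ diagramHomπ X Y c) : f = g :=
  end_.hom_ext h

lemma exists_diagramHom_lift {Z : M} (g : ∀ c, Z ⟶ (ihom (X.obj c)).obj (Y.obj c))
    (hg : ∀ (b c : K) (f : b ⟶ c),
      g b ≫ (ihom (X.obj b)).map (Y.map f) = g c ≫ (pre (X.map f)).app (Y.obj c)) :
    ∃ h : Z ⟶ (X ⟶[M] Y), ∀ c, h ≫ diagramHomπ X Y c = g c :=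
  ⟨end_.lift (F := Enriched.FunctorCategory.diagram M X Y) g fun b c f ↦ by
    refine Eq.trans ?_ ((hg b c f).trans ?_)
    · exact congrArg (g b ≫ ·) (enrichedOrdinaryCategorySelf_eHomWhiskerLeft _ _ _)
    · exact congrArg (g c ≫ ·) (enrichedOrdinaryCategorySelf_eHomWhiskerRight _ _ _).symm,
    fun c ↦ end_.lift_π _ _ _⟩

lemma eComp_diagramHomπ (X Y W : K ⥤ M) (c : K) :
    eComp M X Y W ≫ diagramHomπ X W c =
      (diagramHomπ X Y c ⊗ₘ diagramHomπ Y W c) ≫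
        MonoidalClosed.comp (X.obj c) (Y.obj c) (W.obj c) :=
  Enriched.FunctorCategory.enrichedComp_π M X Y W c

lemma eHomEquiv_diagramHomπ (f : X ⟶ Y) (c : K) :
    eHomEquiv M f ≫ diagramHomπ X Y c = curry' (f.app c) :=
  Enriched.FunctorCategory.homEquiv_apply_π M f c

/-- Whiskering is enriched composition with the element of the hom object given by `f`; the
projections respect both composition and such elements, so the claim is the corresponding fact for
`M` enriched over itself. -/
lemma eHomWhiskerLeft_diagramHomπ (X : K ⥤ M) {Y W : K ⥤ M} (f : Y ⟶ W) (c : K) :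
    eHomWhiskerLeft M X f ≫ diagramHomπ X W c =
      diagramHomπ X Y c ≫ (ihom (X.obj c)).map (f.app c) := by
  rw [← enrichedOrdinaryCategorySelf_eHomWhiskerLeft, eHomWhiskerLeft, eHomWhiskerLeft,
    Category.assoc, Category.assoc, eComp_diagramHomπ, tensorHom_def', ← Category.assoc (_ ◁ _),
    ← Category.assoc (_ ◁ _), ← MonoidalCategory.whiskerLeft_comp, eHomEquiv_diagramHomπ,
    whisker_exchange, Category.assoc, MonoidalCategory.whiskerRight_id]
  simp only [Category.assoc, Iso.inv_hom_id_assoc]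
  rfl

lemma eHomWhiskerRight_diagramHomπ {X Y : K ⥤ M} (f : X ⟶ Y) (W : K ⥤ M) (c : K) :
    eHomWhiskerRight M f W ≫ diagramHomπ X W c =
      diagramHomπ Y W c ≫ (pre (f.app c)).app (W.obj c) := by
  rw [← enrichedOrdinaryCategorySelf_eHomWhiskerRight, eHomWhiskerRight, eHomWhiskerRight,
    Category.assoc, Category.assoc, eComp_diagramHomπ, MonoidalCategory.tensorHom_def, ← Category.assoc (_ ▷ _),
    ← Category.assoc (_ ▷ _), ← comp_whiskerRight, eHomEquiv_diagramHomπ,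
    ← whisker_exchange, Category.assoc, MonoidalCategory.id_whiskerLeft]
  simp only [Category.assoc, Iso.inv_hom_id_assoc]
  rfl

/-- A morphism to `[Z, Hom(X, Y)]` which is given componentwise by natural isomorphisms is an
isomorphism. -/
lemma isIso_of_diagramHomπ {Z : M} {X' Y' : K ⥤ M}
    (k : (X' ⟶[M] Y') ⟶ (ihom Z).obj (X ⟶[M] Y))
    (κ : ∀ b c, (ihom (X'.obj b)).obj (Y'.obj c) ⟶ (ihom Z).obj ((ihom (X.obj b)).obj (Y.obj c)))
    (hκ₀ : ∀ b c, IsIso (κ b c))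
    (hκ : ∀ (b c : K) (f : b ⟶ c), κ b b ≫ (ihom Z).map ((ihom (X.obj b)).map (Y.map f)) =
      (ihom (X'.obj b)).map (Y'.map f) ≫ κ b c)
    (hκ' : ∀ (b c : K) (f : b ⟶ c), κ c c ≫ (ihom Z).map ((pre (X.map f)).app (Y.obj c)) =
      (pre (X'.map f)).app (Y'.obj c) ≫ κ b c)
    (hk : ∀ c, k ≫ (ihom Z).map (diagramHomπ X Y c) = diagramHomπ X' Y' c ≫ κ c c) : IsIso k := by
  -- The inverse is assembled from the inverses of the diagonal `κ c c`. Its wedge condition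
  -- compares morphisms into an off-diagonal internal hom, which is why `κ` has two indices.
  obtain ⟨l, hl⟩ := exists_diagramHom_lift (X := X') (Y := Y')
    (fun c ↦ (ihom Z).map (diagramHomπ X Y c) ≫ inv (κ c c)) (fun b c f ↦ by
      rw [← cancel_mono (κ b c), Category.assoc, Category.assoc, ← hκ, IsIso.inv_hom_id_assoc,
        ← (ihom Z).map_comp, diagramHom_condition, Category.assoc, Category.assoc, ← hκ',
        IsIso.inv_hom_id_assoc, ← (ihom Z).map_comp])
  refine ⟨l, diagramHom_hom_ext fun c ↦ ?_, uncurry_injective (diagramHom_hom_ext fun c ↦ ?_)⟩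
  · rw [Category.assoc, hl, ← Category.assoc, hk, Category.assoc, IsIso.hom_inv_id,
      Category.comp_id, Category.id_comp]
  · rw [← uncurry_natural_right, ← uncurry_natural_right, Category.assoc, hk, ← Category.assoc, hl,
      Category.assoc, IsIso.inv_hom_id, Category.comp_id, Category.id_comp]

end DiagramHom

/-! ### Canonical isomorphisms between iterated internal homs -/

section InternalHom

open MonoidalClosed

variable {M : Type u} [Category.{v} M] [MonoidalCategory M] [MonoidalClosed M]

lemma uncurry_eq_whiskerLeft {A B W : M} (g : W ⟶ (ihom A).obj B) :
    uncurry g = A ◁ g ≫ uncurry (𝟙 ((ihom A).obj B)) := by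
  rw [← uncurry_natural_left, Category.comp_id]

lemma uncurry_tensorHom_comp {A B C U W : M} (g : U ⟶ (ihom A).obj B) (k : W ⟶ (ihom B).obj C) :
    uncurry ((g ⊗ₘ k) ≫ MonoidalClosed.comp A B C) =
      (α_ A U W).inv ≫ uncurry g ▷ W ≫ uncurry k := by
  have h : uncurry (MonoidalClosed.comp A B C) = (α_ _ _ _).inv ≫ uncurry (𝟙 _) ▷ _ ≫
      uncurry (𝟙 _) := by
    rw [MonoidalClosed.comp, uncurry_curry, compTranspose_eq, uncurry_id_eq_ev, uncurry_id_eq_ev]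
  rw [uncurry_natural_left, h, uncurry_eq_whiskerLeft g, uncurry_eq_whiskerLeft k,
    MonoidalCategory.tensorHom_def, MonoidalCategory.whiskerLeft_comp_assoc,
    associator_inv_naturality_right_assoc, whisker_exchange_assoc,
    associator_inv_naturality_middle_assoc, comp_whiskerRight_assoc]

lemma uncurry_uncurry_ihom_map {Z A B B' W : M} (k : W ⟶ (ihom Z).obj ((ihom A).obj B))
    (b : B ⟶ B') : uncurry (uncurry (k ≫ (ihom Z).map ((ihom A).map b))) =
      uncurry (uncurry k) ≫ b := by
  rw [uncurry_natural_right, uncurry_natural_right]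

lemma uncurry_uncurry_pre {Z A A' B W : M} (k : W ⟶ (ihom Z).obj ((ihom A).obj B))
    (a : A' ⟶ A) : uncurry (uncurry (k ≫ (ihom Z).map ((pre a).app B))) =
      a ▷ _ ≫ uncurry (uncurry k) := by
  rw [uncurry_natural_right, uncurry_pre_app]

lemma uncurry_uncurry_natural_left {Z A B W W' : M} (g : W' ⟶ W)
    (k : W ⟶ (ihom Z).obj ((ihom A).obj B)) : uncurry (uncurry (g ≫ k)) =
      A ◁ Z ◁ g ≫ uncurry (uncurry k) := by
  rw [uncurry_natural_left, uncurry_natural_left]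

variable [SymmetricCategory M]

/-- The canonical morphism `[Z ⊗ A, B] ⟶ [Z, [A, B]]`. -/
def ihomTensorComparison (Z A B : M) :
    (ihom (Z ⊗ A)).obj B ⟶ (ihom Z).obj ((ihom A).obj B) :=
  curry ((curry (β_ A Z).hom ⊗ₘ 𝟙 _) ≫ MonoidalClosed.comp A (Z ⊗ A) B)

lemma curry_comp_eq_ihomTensorComparison {Z A B W : M} (g : W ⟶ (ihom (Z ⊗ A)).obj B) :
    curry ((curry (β_ A Z).hom ⊗ₘ g) ≫ MonoidalClosed.comp A (Z ⊗ A) B) =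
      g ≫ ihomTensorComparison Z A B := by
  rw [ihomTensorComparison, ← curry_natural_left, ← id_tensorHom,
    tensorHom_comp_tensorHom_assoc, Category.id_comp, Category.comp_id]

/-- After uncurrying twice, the comparison is precomposition with an associator and a braiding.
Invertibility and naturality are both read off from this formula. -/
lemma uncurry_uncurry_ihomTensorComparison {Z A B W : M} (g : W ⟶ (ihom (Z ⊗ A)).obj B) :
    uncurry (uncurry (g ≫ ihomTensorComparison Z A B)) =
      (α_ A Z W).inv ≫ (β_ A Z).hom ▷ W ≫ uncurry g := by
  rw [uncurry_uncurry_natural_left, ihomTensorComparison, uncurry_curry, uncurry_tensorHom_comp,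
    uncurry_curry, associator_inv_naturality_right_assoc, whisker_exchange_assoc,
    ← uncurry_eq_whiskerLeft]

lemma isIso_ihomTensorComparison (Z A B : M) : IsIso (ihomTensorComparison Z A B) := by
  have h := uncurry_uncurry_ihomTensorComparison (𝟙 ((ihom (Z ⊗ A)).obj B))
  rw [Category.id_comp] at h
  refine ⟨curry ((β_ A Z).inv ▷ _ ≫ (α_ A Z _).hom ≫ uncurry (uncurry (𝟙 _))),
    uncurry_injective ?_, uncurry_injective (uncurry_injective ?_)⟩
  · rw [uncurry_natural_left, uncurry_curry, whisker_exchange_assoc,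
      associator_naturality_right_assoc, ← uncurry_uncurry_natural_left, Category.comp_id, h,
      Iso.hom_inv_id_assoc, inv_hom_whiskerRight_assoc]
  · rw [uncurry_uncurry_ihomTensorComparison, uncurry_curry, hom_inv_whiskerRight_assoc,
      Iso.inv_hom_id_assoc]

/-- The canonical morphism `[A, [Z, B]] ⟶ [Z, [A, B]]`. -/
def ihomSwap (Z A B : M) :
    (ihom A).obj ((ihom Z).obj B) ⟶ (ihom Z).obj ((ihom A).obj B) :=
  curry ((β_ Z _).hom ≫
    (𝟙 _ ⊗ₘ curry ((β_ ((ihom Z).obj B) Z).hom ≫ uncurry (𝟙 ((ihom Z).obj B)))) ≫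
      MonoidalClosed.comp A ((ihom Z).obj B) B)

lemma curry_comp_eq_ihomSwap {Z A B W : M} (g : W ⟶ (ihom A).obj ((ihom Z).obj B)) :
    curry ((β_ Z W).hom ≫
      (g ⊗ₘ curry ((β_ ((ihom Z).obj B) Z).hom ≫ uncurry (𝟙 ((ihom Z).obj B)))) ≫
        MonoidalClosed.comp A ((ihom Z).obj B) B) = g ≫ ihomSwap Z A B := by
  rw [ihomSwap, ← curry_natural_left, BraidedCategory.braiding_naturality_right_assoc,
    ← tensorHom_id, tensorHom_comp_tensorHom_assoc, Category.id_comp, Category.comp_id]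

lemma uncurry_uncurry_ihomSwap {Z A B W : M} (g : W ⟶ (ihom A).obj ((ihom Z).obj B)) :
    uncurry (uncurry (g ≫ ihomSwap Z A B)) =
      (α_ A Z W).inv ≫ (β_ A Z).hom ▷ W ≫ (α_ Z A W).hom ≫ uncurry (uncurry g) := by
  rw [uncurry_uncurry_natural_left, ihomSwap, uncurry_curry, uncurry_natural_left,
    uncurry_tensorHom_comp, uncurry_curry, BraidedCategory.braiding_naturality_left_assoc,
    -- The hexagon splits the braiding of `A ⊗ W` past `Z`. The part exchanging `W` and `Z` cancels
    -- against the braiding in `ihomSwap`, which requires symmetry.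
    ← uncurry_eq_whiskerLeft, BraidedCategory.braiding_tensor_left_hom, Category.assoc,
    Category.assoc, Category.assoc, Category.assoc, Iso.inv_hom_id_assoc,
    ← MonoidalCategory.whiskerLeft_comp_assoc A (β_ Z _).hom, SymmetricCategory.symmetry,
    MonoidalCategory.whiskerLeft_id, Category.id_comp, uncurry_eq_whiskerLeft g,
    uncurry_natural_left, associator_inv_naturality_right_assoc, whisker_exchange_assoc,
    associator_naturality_right_assoc]

/-- Exchanging `Z` and `A` twice is the identity, again by symmetry of the braiding. -/
lemma isIso_ihomSwap (Z A B : M) : IsIso (ihomSwap Z A B) := by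
  have h (Z A B : M) : ihomSwap Z A B ≫ ihomSwap A Z B = 𝟙 _ := by
    apply uncurry_injective
    apply uncurry_injective
    have h' := uncurry_uncurry_ihomSwap (𝟙 ((ihom A).obj ((ihom Z).obj B)))
    rw [Category.id_comp] at h'
    rw [uncurry_uncurry_ihomSwap, h', Iso.hom_inv_id_assoc, ← comp_whiskerRight_assoc,
      SymmetricCategory.symmetry, id_whiskerRight, Category.id_comp, Iso.inv_hom_id_assoc]
  exact ⟨ihomSwap A Z B, h Z A B, h A Z B⟩

end InternalHom

/-! ### Tensors and cotensors in a diagram category -/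

section DiagramTensor

variable {K : Type w} [Category.{w} K] {M : Type u} [Category.{v} M] [MonoidalCategory M]
  {Z : M} {X Y : K ⥤ M}

/-- The components of a morphism `Z ⊗ X ⟶ Y`. -/
def diagramTensorApp (g : ((diagramTensor K M).obj Z).obj X ⟶ Y) (c : K) :
    Z ⊗ X.obj c ⟶ Y.obj c :=
  g.app c

/-- Constructor for morphisms `Z ⊗ X ⟶ Y`. -/
def diagramTensorDesc (g : ∀ c, Z ⊗ X.obj c ⟶ Y.obj c)
    (hg : ∀ (b c : K) (f : b ⟶ c), Z ◁ X.map f ≫ g c = g b ≫ Y.map f) :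
    ((diagramTensor K M).obj Z).obj X ⟶ Y where
  app := g
  naturality := hg

lemma diagramTensorApp_desc (g : ∀ c, Z ⊗ X.obj c ⟶ Y.obj c)
    (hg : ∀ (b c : K) (f : b ⟶ c), Z ◁ X.map f ≫ g c = g b ≫ Y.map f) (c : K) :
    diagramTensorApp (diagramTensorDesc g hg) c = g c :=
  rfl

lemma diagramTensor_hom_ext {g g' : ((diagramTensor K M).obj Z).obj X ⟶ Y}
    (h : ∀ c, diagramTensorApp g c = diagramTensorApp g' c) : g = g' :=
  NatTrans.ext (funext h)

lemma diagramTensorApp_naturality (g : ((diagramTensor K M).obj Z).obj X ⟶ Y) {b c : K}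
    (f : b ⟶ c) :
    Z ◁ X.map f ≫ diagramTensorApp g c = diagramTensorApp g b ≫ Y.map f :=
  g.naturality f

lemma diagramTensorApp_id (c : K) :
    diagramTensorApp (𝟙 (((diagramTensor K M).obj Z).obj X)) c = 𝟙 _ :=
  rfl

lemma diagramTensorApp_comp (g : ((diagramTensor K M).obj Z).obj X ⟶ Y) {Y' : K ⥤ M} (f : Y ⟶ Y')
    (c : K) : diagramTensorApp (g ≫ f) c = diagramTensorApp g c ≫ f.app c :=
  rfl

lemma diagramTensorApp_map_app_comp {Z' : M} (f : Z' ⟶ Z)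
    (g : ((diagramTensor K M).obj Z).obj X ⟶ Y) (c : K) :
    diagramTensorApp (((diagramTensor K M).map f).app X ≫ g) c =
      f ▷ X.obj c ≫ diagramTensorApp g c :=
  rfl

lemma diagramTensorApp_obj_map_comp {X' : K ⥤ M} (f : X' ⟶ X)
    (g : ((diagramTensor K M).obj Z).obj X ⟶ Y) (c : K) :
    diagramTensorApp (((diagramTensor K M).obj Z).map f ≫ g) c =
      Z ◁ f.app c ≫ diagramTensorApp g c :=
  rfl

variable [MonoidalClosed M]

/-- The components of a morphism `X ⟶ Y ^ Z`. -/
def diagramCotensorApp (g : X ⟶ ((diagramCotensor K M).obj (op Z)).obj Y) (c : K) :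
    X.obj c ⟶ (ihom Z).obj (Y.obj c) :=
  g.app c

/-- Constructor for morphisms `X ⟶ Y ^ Z`. -/
def diagramCotensorLift (g : ∀ c, X.obj c ⟶ (ihom Z).obj (Y.obj c))
    (hg : ∀ (b c : K) (f : b ⟶ c), X.map f ≫ g c = g b ≫ (ihom Z).map (Y.map f)) :
    X ⟶ ((diagramCotensor K M).obj (op Z)).obj Y where
  app := g
  naturality := hg

lemma diagramCotensorApp_lift (g : ∀ c, X.obj c ⟶ (ihom Z).obj (Y.obj c))
    (hg : ∀ (b c : K) (f : b ⟶ c), X.map f ≫ g c = g b ≫ (ihom Z).map (Y.map f)) (c : K) :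
    diagramCotensorApp (diagramCotensorLift g hg) c = g c :=
  rfl

lemma diagramCotensor_hom_ext {g g' : X ⟶ ((diagramCotensor K M).obj (op Z)).obj Y}
    (h : ∀ c, diagramCotensorApp g c = diagramCotensorApp g' c) : g = g' :=
  NatTrans.ext (funext h)

lemma diagramCotensorApp_naturality (g : X ⟶ ((diagramCotensor K M).obj (op Z)).obj Y) {b c : K}
    (f : b ⟶ c) :
    X.map f ≫ diagramCotensorApp g c = diagramCotensorApp g b ≫ (ihom Z).map (Y.map f) :=
  g.naturality f

lemma diagramCotensorApp_id (c : K) :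
    diagramCotensorApp (𝟙 (((diagramCotensor K M).obj (op Z)).obj Y)) c = 𝟙 _ :=
  rfl

lemma diagramCotensorApp_comp {X' : K ⥤ M} (f : X' ⟶ X)
    (g : X ⟶ ((diagramCotensor K M).obj (op Z)).obj Y) (c : K) :
    diagramCotensorApp (f ≫ g) c = f.app c ≫ diagramCotensorApp g c :=
  rfl

lemma diagramCotensorApp_comp_obj_map {Y' : K ⥤ M} (f : Y ⟶ Y')
    (g : X ⟶ ((diagramCotensor K M).obj (op Z)).obj Y) (c : K) :
    diagramCotensorApp (g ≫ ((diagramCotensor K M).obj (op Z)).map f) c =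
      diagramCotensorApp g c ≫ (ihom Z).map (f.app c) :=
  rfl

lemma diagramCotensorApp_comp_map_app {Z' : M} (f : Z' ⟶ Z)
    (g : X ⟶ ((diagramCotensor K M).obj (op Z)).obj Y) (c : K) :
    diagramCotensorApp (g ≫ ((diagramCotensor K M).map f.op).app Y) c =
      diagramCotensorApp g c ≫ (MonoidalClosed.pre f).app (Y.obj c) :=
  rfl

end DiagramTensor

/-! ### The two-variable adjunctions and the comparison isomorphisms -/

section TensoredCotensoredDiagrams

open MonoidalClosed

variable {K : Type w} [Category.{w} K] {M : Type u} [Category.{v} M]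
  [MonoidalCategory M] [SymmetricCategory M] [MonoidalClosed M]

/-- Naturality in both variables, for this comparison and for `ihomSwap`, is what lets the
objectwise isomorphisms pass to ends. -/
lemma ihomTensorComparison_naturality_right (Z A : M) {B B' : M} (b : B ⟶ B') :
    ihomTensorComparison Z A B ≫ (ihom Z).map ((ihom A).map b) =
      (ihom (Z ⊗ A)).map b ≫ ihomTensorComparison Z A B' := by
  apply uncurry_injective
  apply uncurry_injective
  have h := uncurry_uncurry_ihomTensorComparison (𝟙 ((ihom (Z ⊗ A)).obj B))
  rw [Category.id_comp] at h
  rw [uncurry_uncurry_ihom_map, h, uncurry_uncurry_ihomTensorComparison,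
    ← Category.id_comp ((ihom (Z ⊗ A)).map b), uncurry_natural_right, Category.assoc,
    Category.assoc]

lemma ihomTensorComparison_naturality_left (Z : M) {A A' : M} (a : A' ⟶ A) (B : M) :
    ihomTensorComparison Z A B ≫ (ihom Z).map ((pre a).app B) =
      (pre (Z ◁ a)).app B ≫ ihomTensorComparison Z A' B := by
  apply uncurry_injective
  apply uncurry_injective
  have h := uncurry_uncurry_ihomTensorComparison (𝟙 ((ihom (Z ⊗ A)).obj B))
  rw [Category.id_comp] at h
  rw [uncurry_uncurry_pre, h, uncurry_uncurry_ihomTensorComparison,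
    ← Category.id_comp ((pre (Z ◁ a)).app B), uncurry_pre_app,
    associator_inv_naturality_left_assoc, ← comp_whiskerRight_assoc, ← comp_whiskerRight_assoc,
    BraidedCategory.braiding_naturality_left]

lemma ihomSwap_naturality_right (Z A : M) {B B' : M} (b : B ⟶ B') :
    ihomSwap Z A B ≫ (ihom Z).map ((ihom A).map b) =
      (ihom A).map ((ihom Z).map b) ≫ ihomSwap Z A B' := by
  apply uncurry_injective
  apply uncurry_injective
  have h := uncurry_uncurry_ihomSwap (𝟙 ((ihom A).obj ((ihom Z).obj B)))
  rw [Category.id_comp] at h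
  rw [uncurry_uncurry_ihom_map, h, uncurry_uncurry_ihomSwap,
    ← Category.id_comp ((ihom A).map ((ihom Z).map b)), uncurry_uncurry_ihom_map, Category.assoc,
    Category.assoc, Category.assoc]

lemma ihomSwap_naturality_left (Z : M) {A A' : M} (a : A' ⟶ A) (B : M) :
    ihomSwap Z A B ≫ (ihom Z).map ((pre a).app B) =
      (pre a).app ((ihom Z).obj B) ≫ ihomSwap Z A' B := by
  apply uncurry_injective
  apply uncurry_injective
  have h := uncurry_uncurry_ihomSwap (𝟙 ((ihom A).obj ((ihom Z).obj B)))
  rw [Category.id_comp] at h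
  rw [uncurry_uncurry_pre, h, uncurry_uncurry_ihomSwap,
    ← Category.id_comp ((pre a).app ((ihom Z).obj B)), uncurry_pre_app, uncurry_natural_left,
    associator_inv_naturality_left_assoc, ← comp_whiskerRight_assoc,
    BraidedCategory.braiding_naturality_left, comp_whiskerRight_assoc,
    associator_naturality_middle_assoc]

/-- The bijection between morphisms `Z ⊗ X ⟶ Y` and `X ⟶ Y ^ Z`. -/
def diagramCotensorEquiv (Z : M) (X Y : K ⥤ M) :
    (((diagramTensor K M).obj Z).obj X ⟶ Y) ≃ (X ⟶ ((diagramCotensor K M).obj (op Z)).obj Y) where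
  toFun g := diagramCotensorLift (fun c ↦ curry (diagramTensorApp g c)) fun b c f ↦ by
    rw [← curry_natural_left, ← curry_natural_right, diagramTensorApp_naturality]
  invFun g := diagramTensorDesc (fun c ↦ uncurry (diagramCotensorApp g c)) fun b c f ↦ by
    rw [← uncurry_natural_left, ← uncurry_natural_right, diagramCotensorApp_naturality]
  left_inv g := diagramTensor_hom_ext fun c ↦ by
    rw [diagramTensorApp_desc, diagramCotensorApp_lift, uncurry_curry]
  right_inv g := diagramCotensor_hom_ext fun c ↦ by
    rw [diagramCotensorApp_lift, diagramTensorApp_desc, curry_uncurry]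

lemma diagramCotensorApp_diagramCotensorEquiv {Z : M} {X Y : K ⥤ M}
    (g : ((diagramTensor K M).obj Z).obj X ⟶ Y) (c : K) :
    diagramCotensorApp (diagramCotensorEquiv Z X Y g) c = curry (diagramTensorApp g c) :=
  rfl

lemma diagramTensorApp_diagramCotensorEquiv_symm {Z : M} {X Y : K ⥤ M}
    (g : X ⟶ ((diagramCotensor K M).obj (op Z)).obj Y) (c : K) :
    diagramTensorApp ((diagramCotensorEquiv Z X Y).symm g) c =
      uncurry (diagramCotensorApp g c) :=
  rfl

variable (K) in
/-- The adjunction between the objectwise tensoring and the objectwise cotensoring with `Z`. -/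
def diagramCotensorAdjunction (Z : M) :
    (diagramTensor K M).obj Z ⊣ (diagramCotensor K M).obj (op Z) :=
  Adjunction.mkOfHomEquiv
    { homEquiv := diagramCotensorEquiv Z
      homEquiv_naturality_left_symm := fun f g ↦ diagramTensor_hom_ext fun c ↦ by
        rw [diagramTensorApp_diagramCotensorEquiv_symm, diagramTensorApp_obj_map_comp,
          diagramTensorApp_diagramCotensorEquiv_symm, diagramCotensorApp_comp,
          uncurry_natural_left]
      homEquiv_naturality_right := fun g f ↦ diagramCotensor_hom_ext fun c ↦ by
        rw [diagramCotensorApp_diagramCotensorEquiv, diagramCotensorApp_comp_obj_map,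
          diagramCotensorApp_diagramCotensorEquiv, diagramTensorApp_comp, curry_natural_right] }

lemma diagramCotensorAdjunction_homEquiv (Z : M) (X Y : K ⥤ M) :
    (diagramCotensorAdjunction K Z).homEquiv X Y = diagramCotensorEquiv Z X Y := by
  rw [diagramCotensorAdjunction, Adjunction.mkOfHomEquiv_homEquiv]

variable (K M) in
/-- The adjunction between the objectwise tensoring and the objectwise cotensoring. -/
def diagramCotensorAdj : diagramTensor K M ⊣₂ diagramCotensor K M :=
  .mk' (diagramCotensorAdjunction K)
    (fun f X Y g ↦ diagramCotensor_hom_ext fun c ↦ by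
      rw [diagramCotensorAdjunction_homEquiv, diagramCotensorAdjunction_homEquiv,
        diagramCotensorApp_diagramCotensorEquiv, diagramCotensorApp_comp_map_app,
        diagramCotensorApp_diagramCotensorEquiv, diagramTensorApp_map_app_comp, curry_pre_app])

lemma diagramCotensorAdj_homEquiv (Z : M) (X Y : K ⥤ M) :
    (diagramCotensorAdj K M).homEquiv (X₁ := Z) (X₂ := X) (X₃ := Y) =
      diagramCotensorEquiv Z X Y :=
  diagramCotensorAdjunction_homEquiv Z X Y

variable [HasLimitsOfSize.{w, w} M]

/-- The bijection between morphisms `Z ⊗ X ⟶ Y` and `Z ⟶ Hom(X, Y)`. -/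
lemma exists_diagramHomEquiv (Z : M) (X Y : K ⥤ M) :
    ∃ e : (((diagramTensor K M).obj Z).obj X ⟶ Y) ≃ (Z ⟶ (X ⟶[M] Y)),
      ∀ g c, e g ≫ diagramHomπ X Y c = curry ((β_ (X.obj c) Z).hom ≫ diagramTensorApp g c) := by
  have h₁ (g : ((diagramTensor K M).obj Z).obj X ⟶ Y) : ∃ h : Z ⟶ (X ⟶[M] Y),
      ∀ c, h ≫ diagramHomπ X Y c = curry ((β_ (X.obj c) Z).hom ≫ diagramTensorApp g c) :=
    -- The wedge condition is the naturality of `g`. The braiding appears because currying removes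
    -- the left tensor factor, whereas `X_c` stands on the right in `Z ⊗ X_c`.
    exists_diagramHom_lift _ fun b c f ↦ by
      rw [← curry_natural_right, curry_pre_app, Category.assoc, ← diagramTensorApp_naturality,
        BraidedCategory.braiding_naturality_left_assoc]
  have h₂ (h : Z ⟶ (X ⟶[M] Y)) : ∃ g : ((diagramTensor K M).obj Z).obj X ⟶ Y,
      ∀ c, diagramTensorApp g c = (β_ (X.obj c) Z).inv ≫ uncurry (h ≫ diagramHomπ X Y c) := by
    refine ⟨diagramTensorDesc _ fun b c f ↦ ?_, diagramTensorApp_desc _ _⟩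
    rw [Category.assoc, ← uncurry_natural_right, Category.assoc, diagramHom_condition,
      ← Category.assoc h, uncurry_pre_app, BraidedCategory.braiding_inv_naturality_right_assoc]
  choose e he using h₁
  choose e' he' using h₂
  refine ⟨⟨e, e', fun g ↦ diagramTensor_hom_ext fun c ↦ ?_, fun h ↦ diagramHom_hom_ext fun c ↦ ?_⟩,
    he⟩
  · rw [he', he, uncurry_curry, Iso.inv_hom_id_assoc]
  · rw [he, he', Iso.hom_inv_id_assoc, curry_uncurry]

/-- The bijection between morphisms `Z ⊗ X ⟶ Y` and `Z ⟶ Hom(X, Y)`. -/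
def diagramHomEquiv (Z : M) (X Y : K ⥤ M) :
    (((diagramTensor K M).obj Z).obj X ⟶ Y) ≃ (Z ⟶ (X ⟶[M] Y)) :=
  (exists_diagramHomEquiv Z X Y).choose

lemma diagramHomEquiv_diagramHomπ {Z : M} {X Y : K ⥤ M}
    (g : ((diagramTensor K M).obj Z).obj X ⟶ Y) (c : K) :
    diagramHomEquiv Z X Y g ≫ diagramHomπ X Y c =
      curry ((β_ (X.obj c) Z).hom ≫ diagramTensorApp g c) :=
  (exists_diagramHomEquiv Z X Y).choose_spec g c

lemma diagramHomEquiv_naturality_left {Z Z' : M} {X Y : K ⥤ M} (f : Z' ⟶ Z)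
    (g : ((diagramTensor K M).obj Z).obj X ⟶ Y) :
    diagramHomEquiv Z' X Y (((diagramTensor K M).map f).app X ≫ g) =
      f ≫ diagramHomEquiv Z X Y g :=
  diagramHom_hom_ext fun c ↦ by
    rw [diagramHomEquiv_diagramHomπ, Category.assoc, diagramHomEquiv_diagramHomπ,
      diagramTensorApp_map_app_comp, ← curry_natural_left,
      BraidedCategory.braiding_naturality_right_assoc]

lemma diagramHomEquiv_naturality_right {Z : M} {X Y Y' : K ⥤ M} (f : Y ⟶ Y')
    (g : ((diagramTensor K M).obj Z).obj X ⟶ Y) :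
    diagramHomEquiv Z X Y' (g ≫ f) = diagramHomEquiv Z X Y g ≫ eHomWhiskerLeft M X f :=
  diagramHom_hom_ext fun c ↦ by
    rw [diagramHomEquiv_diagramHomπ, Category.assoc, eHomWhiskerLeft_diagramHomπ, ← Category.assoc,
      diagramHomEquiv_diagramHomπ, diagramTensorApp_comp, ← curry_natural_right, Category.assoc]

lemma diagramHomEquiv_naturality_middle {Z : M} {X X' Y : K ⥤ M} (f : X' ⟶ X)
    (g : ((diagramTensor K M).obj Z).obj X ⟶ Y) :
    diagramHomEquiv Z X' Y (((diagramTensor K M).obj Z).map f ≫ g) =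
      diagramHomEquiv Z X Y g ≫ eHomWhiskerRight M f Y :=
  diagramHom_hom_ext fun c ↦ by
    rw [diagramHomEquiv_diagramHomπ, Category.assoc, eHomWhiskerRight_diagramHomπ,
      ← Category.assoc, diagramHomEquiv_diagramHomπ, diagramTensorApp_obj_map_comp, curry_pre_app,
      BraidedCategory.braiding_naturality_left_assoc]

/-- The adjunction between the objectwise tensoring of `X` and the enriched hom from `X`. -/
def diagramHomAdjunction (X : K ⥤ M) :
    (diagramTensor K M).flip.obj X ⊣ (eHomFunctor M (K ⥤ M)).obj (op X) :=
  Adjunction.mkOfHomEquiv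
    { homEquiv := fun Z Y ↦ diagramHomEquiv Z X Y
      homEquiv_naturality_left_symm := fun {Z Z' Y} f g ↦ by
        apply (diagramHomEquiv Z X Y).injective
        refine Eq.trans ?_ (diagramHomEquiv_naturality_left f _).symm
        exact ((diagramHomEquiv Z X Y).apply_symm_apply _).trans
          (congrArg (f ≫ ·) ((diagramHomEquiv Z' X Y).apply_symm_apply g).symm)
      homEquiv_naturality_right := fun g f ↦ diagramHomEquiv_naturality_right f g }

lemma diagramHomAdjunction_homEquiv (Z : M) (X Y : K ⥤ M) :
    (diagramHomAdjunction X).homEquiv Z Y = diagramHomEquiv Z X Y := by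
  rw [diagramHomAdjunction, Adjunction.mkOfHomEquiv_homEquiv]

variable (K M) in
/-- The adjunction between the objectwise tensoring and the enriched hom. -/
def diagramHomAdj : (diagramTensor K M).flip ⊣₂ eHomFunctor M (K ⥤ M) :=
  .mk' diagramHomAdjunction
    (fun f Z Y g ↦ by
      rw [diagramHomAdjunction_homEquiv, diagramHomAdjunction_homEquiv]
      exact diagramHomEquiv_naturality_middle f g)

lemma diagramHomAdj_homEquiv_diagramHomπ {Z : M} {X Y : K ⥤ M}
    (g : ((diagramTensor K M).obj Z).obj X ⟶ Y) (c : K) :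
    (diagramHomAdj K M).homEquiv (X₁ := X) (X₂ := Z) (X₃ := Y) g ≫ diagramHomπ X Y c =
      curry ((β_ (X.obj c) Z).hom ≫ diagramTensorApp g c) :=
  (congrArg (fun e : (((diagramTensor K M).obj Z).obj X ⟶ Y) ≃ (Z ⟶ (X ⟶[M] Y)) ↦
    e g ≫ diagramHomπ X Y c) (diagramHomAdjunction_homEquiv Z X Y)).trans
      (diagramHomEquiv_diagramHomπ g c)

lemma tensorUnitMap_diagramHomπ (Z : M) (X : K ⥤ M) (c : K) :
    tensorUnitMap (diagramHomAdj K M) Z X ≫ diagramHomπ X (((diagramTensor K M).obj Z).obj X) c =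
      curry (β_ (X.obj c) Z).hom := by
  refine (diagramHomAdj_homEquiv_diagramHomπ _ c).trans (congrArg curry ?_)
  rw [diagramTensorApp_id]
  exact Category.comp_id _

lemma cotensorCounitMap_diagramHomπ (Z : M) (Y : K ⥤ M) (c : K) :
    cotensorCounitMap (diagramHomAdj K M) (diagramCotensorAdj K M) Z Y ≫
        diagramHomπ (((diagramCotensor K M).obj (op Z)).obj Y) Y c =
      curry ((β_ ((ihom Z).obj (Y.obj c)) Z).hom ≫ uncurry (𝟙 ((ihom Z).obj (Y.obj c)))) := by
  refine (diagramHomAdj_homEquiv_diagramHomπ _ c).trans (congrArg curry ?_)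
  rw [diagramCotensorAdj_homEquiv, diagramTensorApp_diagramCotensorEquiv_symm,
    diagramCotensorApp_id]
  rfl

/-- The unit `Z ⟶ Hom(X, Z ⊗ X)` has the curried braidings as components, so on projections the
comparison is `ihomTensorComparison`. -/
lemma isIso_tensorComparison_diagramHomAdj (Z : M) (X Y : K ⥤ M) :
    IsIso (tensorComparison (diagramHomAdj K M) Z X Y) := by
  refine isIso_of_diagramHomπ (X' := ((diagramTensor K M).obj Z).obj X) (Y' := Y) _
    (fun b c ↦ ihomTensorComparison Z (X.obj b) (Y.obj c))
    (fun b c ↦ isIso_ihomTensorComparison _ _ _)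
    (fun b c f ↦ ihomTensorComparison_naturality_right _ _ _)
    (fun b c f ↦ ihomTensorComparison_naturality_left _ _ _) fun c ↦ ?_
  rw [tensorComparison, ihomTensorComparison, ← curry_natural_right, Category.assoc,
    eComp_diagramHomπ, ← tensorHom_id, tensorHom_comp_tensorHom_assoc, tensorUnitMap_diagramHomπ,
    Category.id_comp]
  exact curry_comp_eq_ihomTensorComparison _

/-- The counit `Z ⟶ Hom(Y ^ Z, Y)` has curried evaluations, precomposed with the braiding, as
components, so on projections the comparison is `ihomSwap`. -/
lemma isIso_cotensorComparison_diagramHomAdj (Z : M) (X Y : K ⥤ M) :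
    IsIso (cotensorComparison (diagramHomAdj K M) (diagramCotensorAdj K M) Z X Y) := by
  refine isIso_of_diagramHomπ (X' := X) (Y' := ((diagramCotensor K M).obj (op Z)).obj Y) _
    (fun b c ↦ ihomSwap Z (X.obj b) (Y.obj c))
    (fun b c ↦ isIso_ihomSwap _ _ _)
    (fun b c f ↦ ihomSwap_naturality_right _ _ _)
    (fun b c f ↦ ihomSwap_naturality_left _ _ _) fun c ↦ ?_
  rw [cotensorComparison, ihomSwap, ← curry_natural_right, Category.assoc, Category.assoc,
    eComp_diagramHomπ, ← id_tensorHom, tensorHom_comp_tensorHom_assoc,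
    cotensorCounitMap_diagramHomπ, Category.id_comp]
  exact curry_comp_eq_ihomSwap _

variable (K M) in
/-- The category of diagrams is tensored and cotensored. -/
def diagramTensoredCotensored :
    TensoredCotensored M (K ⥤ M) (diagramTensor K M) (diagramCotensor K M) where
  homAdj := diagramHomAdj K M
  cotensorAdj := diagramCotensorAdj K M
  isIso_tensorComparison := isIso_tensorComparison_diagramHomAdj
  isIso_cotensorComparison := isIso_cotensorComparison_diagramHomAdj

end TensoredCotensoredDiagrams

end

theorem mainTheorem5 {M : Type u} [Category.{v} M] [MonoidalCategory M] [SymmetricCategory M]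
    [MonoidalClosed M] [ModelCategory M] [SymmetricMonoidalModelCategory M]
    [HasLimitsOfSize.{w, w} M] [HasColimitsOfSize.{w, w} M]
    {A : Type w} [Category.{w} A] {L R : MorphismProperty A}
    [L.IsMultiplicative] [R.IsMultiplicative]
    {D : Type t} [LinearOrder D] [OrderBot D] [SuccOrder D] [WellFoundedLT D]
    (r : ReedyStructure L R D) :
    ∃ h : ModelCategory (Aᵒᵖ ⥤ M),
      IsReedyModelStructure R.op L.op h ∧
      IsEnrichedModelCategory M (Aᵒᵖ ⥤ M) (diagramTensor Aᵒᵖ M) (diagramCotensor Aᵒᵖ M) := by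
  -- Passing to the opposite category exchanges the roles of the two classes: the lowering maps of
  -- `Aᵒᵖ` are `R.op` and its raising maps are `L.op`.
  let := r.op.modelCategory M
  exact ⟨_, r.op.isReedyModelStructure_modelCategory,
    ⟨⟨diagramTensoredCotensored Aᵒᵖ M⟩,
      r.op.pushoutProductAxiom SymmetricMonoidalModelCategory.pushoutProduct,
      r.op.unitAxiom SymmetricMonoidalModelCategory.unit⟩⟩
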